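/- Let $n\ge 2$ and let $w_0,\dots,w_n$ be positive integers such that the tuple $(w_0,\dots,w_n)$ is well-formed, i.e. $\gcd(w_0,\dots,\widehat{w_i},\dots,w_n)=1$ for every $i$. Let $R=\mathbb{C}[X_0,\dots,X_n]$ be graded by $\deg X_i=w_i$, let $\mathbb{P}=\mathbb{P}(w_0,\dots,w_n)=\operatorname{Proj}R$ be the corresponding (well-formed) weighted projective space, and let $I$ be a homogeneous prime ideal of $R$ with $\operatorname{ht} I<n$. Let $B=R/I$ with the induced grading, and let $X=V_+(I)\subseteq\mathbb{P}$. The variety $X$ is called well-formed if $\mathbb{P}$ is well-formed and $\operatorname{codim}_X(X\cap\operatorname{Sing}\mathbb{P})\ge 2$ (the codimension of the empty set being $\infty$). For an $\mathbb{N}$-graded domain $A=\bigoplus_{i\in\mathbb{N}}A_i$ let $e(A)=\gcd\{i\in\mathbb{N}: A_i\ne 0\}$; $A$ is called saturated in codimension $1$ if $e(A/\mathfrak{p})=e(A)$ for every homogeneous prime ideal $\mathfrak{p}$ of $A$ of height $1$. Then $X$ is well-formed if and only if $e(B)=1$ and $B$ is saturated in codimension $1$. (In particular, if $X$ is well-formed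 then $B$ is saturated in codimension $1$; and if $e(B)=1$, then $X$ is well-formed if and only if $B$ is saturated in codimension $1$.) -/

import Mathlib

namespace WeightedProj

open DirectSum AlgebraicGeometry

section Graded

variable {k A : Type*} [CommRing k] [CommRing A] [Algebra k A]

/-- The grading induced on the quotient `A ⧸ I` by a family `𝒜` of submodules of `A`: its piece of
degree `i` is the image of `𝒜 i`. -/
def quotientGrading (𝒜 : ℕ → Submodule k A) (I : Ideal A) : ℕ → Submodule k (A ⧸ I) :=
  fun i => (𝒜 i).map (Ideal.Quotient.mkₐ k I).toLinearMap

theorem mk_mem_quotientGrading {𝒜 : ℕ → Submodule k A} (I : Ideal A) {i : ℕ} {a : A}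
    (ha : a ∈ 𝒜 i) : Ideal.Quotient.mk I a ∈ quotientGrading 𝒜 I i :=
  ⟨a, ha, rfl⟩

instance quotientGrading.gradedMonoid (𝒜 : ℕ → Submodule k A) [GradedAlgebra 𝒜] (I : Ideal A) :
    SetLike.GradedMonoid (quotientGrading 𝒜 I) where
  one_mem := ⟨1, SetLike.GradedOne.one_mem, rfl⟩
  mul_mem := by
    rintro i j _ _ ⟨a, ha, rfl⟩ ⟨b, hb, rfl⟩
    exact ⟨a * b, SetLike.GradedMul.mul_mem ha hb, map_mul (Ideal.Quotient.mkₐ k I) a b⟩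

/-- The additive map that sends the class of `a` to the family of the classes of its homogeneous
components. -/
noncomputable def quotientDecompose (𝒜 : ℕ → Submodule k A) [GradedAlgebra 𝒜]
    (I : HomogeneousIdeal 𝒜) : (A ⧸ I.toIdeal) →+ ⨁ i, quotientGrading 𝒜 I.toIdeal i :=
  QuotientAddGroup.lift I.toIdeal.toAddSubgroup
    ((DirectSum.map fun i =>
      (((Ideal.Quotient.mkₐ k I.toIdeal).toLinearMap.submoduleMap (𝒜 i)).toAddMonoidHom :
        𝒜 i →+ quotientGrading 𝒜 I.toIdeal i)).comp (decomposeAddEquiv 𝒜).toAddMonoidHom)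
    (by
      intro x hx
      refine DFinsupp.ext fun i => Subtype.ext ?_
      exact Ideal.Quotient.eq_zero_iff_mem.mpr (I.isHomogeneous i hx))

theorem quotientDecompose_mk (𝒜 : ℕ → Submodule k A) [GradedAlgebra 𝒜]
    (I : HomogeneousIdeal 𝒜) {i : ℕ} {a : A} (ha : a ∈ 𝒜 i) :
    quotientDecompose 𝒜 I (Ideal.Quotient.mk I.toIdeal a) =
      DirectSum.of (fun j => quotientGrading 𝒜 I.toIdeal j) i
        ⟨Ideal.Quotient.mk I.toIdeal a, mk_mem_quotientGrading I.toIdeal ha⟩ := by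
  have h : quotientDecompose 𝒜 I (Ideal.Quotient.mk I.toIdeal a) =
      DirectSum.map (fun i =>
        (((Ideal.Quotient.mkₐ k I.toIdeal).toLinearMap.submoduleMap (𝒜 i)).toAddMonoidHom :
          𝒜 i →+ quotientGrading 𝒜 I.toIdeal i)) (decompose 𝒜 a) := rfl
  rw [h, decompose_of_mem 𝒜 ha, DirectSum.map_of]
  rfl

/-- The quotient of a graded algebra by a homogeneous ideal is a graded algebra. -/
noncomputable instance quotientGrading.gradedAlgebra (𝒜 : ℕ → Submodule k A) [GradedAlgebra 𝒜]
    (I : HomogeneousIdeal 𝒜) : GradedAlgebra (quotientGrading 𝒜 I.toIdeal) where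
  toGradedMonoid := quotientGrading.gradedMonoid 𝒜 I.toIdeal
  toDecomposition := DirectSum.Decomposition.ofAddHom _ (quotientDecompose 𝒜 I)
    (by
      ext b
      obtain ⟨a, rfl⟩ := Ideal.Quotient.mk_surjective b
      induction a using DirectSum.Decomposition.inductionOn 𝒜 with
      | zero => simp
      | homogeneous a =>
        simp [quotientDecompose_mk 𝒜 I a.2]
      | add a b ha hb =>
        simp only [map_add, ha, hb])
    (by
      ext i ⟨_, a, ha, rfl⟩ : 2
      exact (congrArg (quotientDecompose 𝒜 I) (DirectSum.coeAddMonoidHom_of _ _ _)).trans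
        (quotientDecompose_mk 𝒜 I ha))

/-- The saturation index `e(B) = gcd {i ∈ ℕ | B_i ≠ 0}` of a graded ring `B`. -/
noncomputable def saturationIndex (ℬ : ℕ → Submodule k A) : ℕ :=
  Nat.setGcd {i | ℬ i ≠ ⊥}

/-- A graded domain `B` is saturated in codimension one if `e(B / 𝔭) = e(B)` for every homogeneous
prime ideal `𝔭` of `B` of height one. -/
def SaturatedInCodimOne (ℬ : ℕ → Submodule k A) [GradedAlgebra ℬ] : Prop :=
  ∀ 𝔭 : HomogeneousIdeal ℬ, 𝔭.toIdeal.IsPrime → 𝔭.toIdeal.height = 1 →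
    saturationIndex (quotientGrading ℬ 𝔭.toIdeal) = saturationIndex ℬ

end Graded

/-- The codimension of a closed subset `Z` of a topological space `X`: the infimum, over the
irreducible closed subsets `Y` of `X` contained in `Z`, of the supremum of the lengths of the chains
`Y = Y₀ ⊂ Y₁ ⊂ ⋯ ⊂ Yₗ` of irreducible closed subsets of `X`. It is `⊤` for `Z = ∅`. -/
noncomputable def codim (X : Type*) [TopologicalSpace X] (Z : Set X) : ℕ∞ :=
  ⨅ (Y : TopologicalSpace.IrreducibleCloseds X) (_ : (Y : Set X) ⊆ Z), Order.coheight Y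

/-- The set of singular points of a scheme: those whose local ring is not regular. -/
def singularLocus (X : Scheme) : Set X :=
  {x | ¬ IsRegularLocalRing (X.presheaf.stalk x)}

/-- A tuple `(w_0, …, w_n)` is well-formed if the gcd of its entries is `1` after deletion of any
single entry. -/
def WellFormedTuple {n : ℕ} (w : Fin (n + 1) → ℕ) : Prop :=
  ∀ i, (Finset.univ.erase i).gcd w = 1

/-- The grading of `ℂ[X_0, …, X_n]` for which `X_i` is homogeneous of degree `w_i`. -/
abbrev grading {n : ℕ} (w : Fin (n + 1) → ℕ) : ℕ → Submodule ℂ (MvPolynomial (Fin (n + 1)) ℂ) :=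
  MvPolynomial.weightedHomogeneousSubmodule ℂ w

noncomputable instance grading.gradedAlgebra {n : ℕ} (w : Fin (n + 1) → ℕ) :
    GradedAlgebra (grading w) :=
  MvPolynomial.weightedGradedAlgebra ℂ w

/-- The weighted projective space `ℙ(w_0, …, w_n)`. -/
noncomputable def weightedProj {n : ℕ} (w : Fin (n + 1) → ℕ) : Scheme :=
  Proj (grading w)

/-- The closed subset `V₊(I)` of `ℙ(w_0, …, w_n)`. -/
def vPlus {n : ℕ} (w : Fin (n + 1) → ℕ) (I : HomogeneousIdeal (grading w)) :
    Set (weightedProj w) :=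
  ProjectiveSpectrum.zeroLocus (grading w) (I : Set (MvPolynomial (Fin (n + 1)) ℂ))

/-- `X = V₊(I) ⊆ ℙ = ℙ(w_0, …, w_n)` is well-formed if `ℙ` is well-formed and
`codim_X (X ∩ Sing ℙ) ≥ 2`. -/
def WellFormed {n : ℕ} (w : Fin (n + 1) → ℕ) (I : HomogeneousIdeal (grading w)) : Prop :=
  WellFormedTuple w ∧
    2 ≤ codim (vPlus w I) ((↑) ⁻¹' singularLocus (weightedProj w) : Set (vPlus w I))

end WeightedProj

/-! For a homogeneous prime `p` of `R`, let d(p) be the gcd of the degrees of homogeneous elements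
outside `p`, that is, e(R/p). The geometric core is `mem_singularLocus_iff`: a point of ℙ is
singular exactly when d(p) ≠ 1.

If d(p) = 1, there are homogeneous elements outside `p` in two consecutive degrees, so `R` localized
at `p` has a homogeneous unit of degree one. The degree zero part R_(p) is pure in R_p, and the unit
moves every homogeneous generator of the maximal ideal into degree zero. Regularity therefore
descends from R_p.

If d = d(p) > 1, some w_j is not divisible by d, so X_j lies in `p`. Let e ≥ 2 be the least positive
integer with d ∣ e w_j. Every element of the maximal ideal of R_(p) has X_j-order at least e, so a
degree zero fraction u = X_j^e · (unit of R_p) is outside its square. Were R_(p) regular, u would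
generate a prime ideal. Well-formedness of the weights supplies a degree zero fraction v with
exactly one factor X_j; then u divides v^e but not v.

Hence codim ≥ 2 says that a prime p ⊇ I of a point with d(p) ≠ 1 is neither I nor minimal among
homogeneous primes strictly above I. The first condition is e(B) = 1, the second is saturation, once
these minimal primes are matched with the homogeneous primes of height one in B. The irrelevant
ideal is the only prime that could spoil the match. If it had height one, B would be integral over
ℂ[f] for a homogeneous f, forcing ht I ≥ n. -/

/-! ### Regular local rings: quotients, integrality, descent along pure maps -/

namespace IsRegularLocalRing

open IsLocalRing

variable {A : Type*} [CommRing A]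

/-- A family of elements of a generating set of the maximal ideal that is linearly independent in
the cotangent space extends, within the generating set, to a minimal generating set. -/
theorem exists_subset_span_eq_top [IsLocalRing A] [IsNoetherianRing A]
    {s T : Set (maximalIdeal A)} (hT : Submodule.span A T = ⊤) (hsT : s ⊆ T)
    (hs : LinearIndepOn (ResidueField A)
      (fun y => ((maximalIdeal A).toCotangent y : CotangentSpace A)) s) :
    ∃ t, s ⊆ t ∧ t ⊆ T ∧ t.Finite ∧ Submodule.span A t = ⊤ ∧
      t.ncard = (maximalIdeal A).spanFinrank := by
  have hli := hs.linearIndepOn_extend hsT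
  have hspan := hs.span_image_extend_eq_span_image hsT
  rw [CotangentSpace.span_image_eq_top_iff.mpr hT] at hspan
  have hfin : (hs.extend hsT).Finite := hli.finite
  refine ⟨hs.extend hsT, hs.subset_extend hsT, hs.extend_subset hsT, hfin,
    CotangentSpace.span_image_eq_top_iff.mp hspan, ?_⟩
  have := hfin.fintype
  have h1 := finrank_span_eq_card hli.linearIndependent
  rw [← Set.image_eq_range, hspan, finrank_top] at h1
  rw [spanFinrank_maximalIdeal_eq_finrank_cotangentSpace, h1, ← Nat.card_coe_set_eq,
    Nat.card_eq_fintype_card]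

theorem span_image_val_eq_maximalIdeal [IsLocalRing A] {t : Set (maximalIdeal A)}
    (ht : Submodule.span A t = ⊤) : Ideal.span ((↑) '' t : Set A) = maximalIdeal A := by
  have h := Submodule.map_span (maximalIdeal A).subtype t
  rw [ht, Submodule.map_top, Submodule.range_subtype] at h
  exact h.symm

/-- Minimal generators of the maximal ideal that contain a given element outside its square. -/
theorem exists_span_insert_eq_maximalIdeal [IsLocalRing A] [IsNoetherianRing A] {x : A}
    (hx : x ∈ maximalIdeal A) (hx2 : x ∉ maximalIdeal A ^ 2) :
    ∃ s : Set A, s.Finite ∧ Ideal.span (insert x s) = maximalIdeal A ∧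
      s.ncard + 1 ≤ (maximalIdeal A).spanFinrank := by
  obtain ⟨t, hxt, -, hfin, hspan, hcard⟩ := exists_subset_span_eq_top (A := A)
    (s := {⟨x, hx⟩}) (T := Set.univ) Submodule.span_univ (Set.subset_univ _)
    (LinearIndepOn.singleton fun h => hx2 ((Ideal.toCotangent_eq_zero _ _).mp h))
  have hxt : ⟨x, hx⟩ ∈ t := hxt rfl
  refine ⟨(↑) '' (t \ {⟨x, hx⟩}), hfin.sdiff.image _, ?_, ?_⟩
  · refine Eq.trans ?_ (span_image_val_eq_maximalIdeal hspan)
    rw [← Set.image_insert_eq (a := ⟨x, hx⟩) (f := ((↑) : maximalIdeal A → A)),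
      Set.insert_sdiff_singleton, Set.insert_eq_of_mem hxt]
  · rw [← hcard, ← Set.ncard_sdiff_singleton_add_one hxt hfin]
    exact Nat.add_le_add_right (Set.ncard_image_le hfin.sdiff) 1

/-- The quotient of a regular local ring by an element outside the square of the maximal ideal is a
regular local ring. -/
theorem quotient_span_singleton [IsRegularLocalRing A] {x : A} (hx : x ∈ maximalIdeal A)
    (hx2 : x ∉ maximalIdeal A ^ 2) :
    IsRegularLocalRing (A ⧸ Ideal.span {x}) ∧
      (maximalIdeal A).spanFinrank ≠ 0 ∧
        ringKrullDim (A ⧸ Ideal.span {x}) = ((maximalIdeal A).spanFinrank - 1 : ℕ) := by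
  obtain ⟨s, hs, hspan, hcard⟩ := exists_span_insert_eq_maximalIdeal hx hx2
  have hle : Ideal.span {x} ≤ maximalIdeal A := (Ideal.span_singleton_le_iff_mem _).mpr hx
  have : Nontrivial (A ⧸ Ideal.span {x}) := Ideal.Quotient.nontrivial_iff.mpr fun h =>
    (maximalIdeal.isMaximal A).ne_top (top_le_iff.mp (h ▸ hle))
  have : IsLocalRing (A ⧸ Ideal.span {x}) :=
    .of_surjective' (Ideal.Quotient.mk _) Ideal.Quotient.mk_surjective
  have hmax : maximalIdeal (A ⧸ Ideal.span {x}) = Ideal.span (Ideal.Quotient.mk _ '' s) := by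
    rw [← IsLocalRing.map_maximalIdeal_of_surjective (Ideal.Quotient.mk (Ideal.span {x}))
      Ideal.Quotient.mk_surjective, ← hspan, Ideal.map_span, Set.image_insert_eq,
      Ideal.span_insert]
    simp
  have h1 : (maximalIdeal (A ⧸ Ideal.span {x})).spanFinrank ≤ s.ncard := by
    rw [hmax]
    exact (Submodule.spanFinrank_span_le_ncard_of_finite (hs.image _)).trans (Set.ncard_image_le hs)
  -- The number of generators drops by at least one and the dimension by at most one, so dimension
  -- and embedding dimension of the quotient agree.
  have h2 := ringKrullDim_le_spanFinrank_maximalIdeal (A ⧸ Ideal.span {x})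
  have h3 : ringKrullDim A ≤ ringKrullDim (A ⧸ Ideal.span {x}) + 1 := by
    have := ringKrullDim_le_ringKrullDim_quotient_add_card (R := A) {x} (by
      simpa [IsLocalRing.ringJacobson_eq_maximalIdeal] using hx)
    rwa [Finset.coe_singleton, Finset.card_singleton, Nat.cast_one] at this
  rw [← (isRegularLocalRing_iff A).mp ‹_›] at h3
  obtain ⟨d, hd⟩ : ∃ d : ℕ, ringKrullDim (A ⧸ Ideal.span {x}) = d := by
    have := WithBot.coe_unbot _ (ringKrullDim_ne_bot (R := A ⧸ Ideal.span {x}))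
    rw [← this, ← ENat.natCast_toNat (n := WithBot.unbot _ ringKrullDim_ne_bot)]
    · exact ⟨_, rfl⟩
    · intro h
      rw [h] at this
      exact ringKrullDim_ne_top this.symm
  rw [hd] at h2 h3 ⊢
  norm_cast at h2 h3 ⊢
  refine ⟨?_, by omega, by omega⟩
  apply of_spanFinrank_maximalIdeal_le
  rw [hd]
  norm_cast
  omega

/-- A regular local ring is a domain, by induction on its embedding dimension. -/
theorem isDomain_of_spanFinrank_eq (r : ℕ) : ∀ (A : Type*) [CommRing A] [IsRegularLocalRing A],
    (maximalIdeal A).spanFinrank = r → IsDomain A := by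
  induction r with
  | zero =>
    intro A _ _ h
    rw [Submodule.spanFinrank_eq_zero_iff_eq_bot (maximalIdeal A).fg_of_isNoetherianRing] at h
    exact (isField_iff_maximalIdeal_eq.mpr h).isDomain
  | succ r ih =>
    intro A _ _ h
    have hdim := (isRegularLocalRing_iff A).mp ‹_›
    rw [h] at hdim
    have hfg := (maximalIdeal A).fg_of_isNoetherianRing
    have hpos : maximalIdeal A ≠ ⊥ := fun h0 => by simp [h0] at h
    -- Prime avoidance tolerates the non-prime member 𝔪². The maximal ideal is not inside 𝔪² by
    -- Nakayama, nor inside a minimal prime because the dimension is positive.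
    obtain ⟨x, hx, hx2⟩ : ∃ x ∈ maximalIdeal A,
        x ∉ ⋃ p ∈ insert (maximalIdeal A ^ 2) (minimalPrimes A), (p : Set A) := by
      by_contra! hcon
      obtain ⟨p, hp, hle⟩ := (Ideal.subset_union_prime_finite
        ((minimalPrimes.finite_of_isNoetherianRing A).insert _) (f := id) (maximalIdeal A ^ 2)
        (maximalIdeal A ^ 2) (fun p hp h _ => ((Set.mem_insert_iff.mp hp).resolve_left h).1.1)).mp
        hcon
      obtain rfl | hp := Set.mem_insert_iff.mp hp
      · refine hpos (Submodule.eq_bot_of_le_smul_of_le_jacobson_bot (maximalIdeal A) _ hfg ?_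
          (IsLocalRing.maximalIdeal_le_jacobson _))
        rwa [id, pow_two] at hle
      · have hpp : p.IsPrime := hp.1.1
        have h0 := Ideal.height_eq_zero_iff.mpr hp
        have h1 : (maximalIdeal A).height ≤ 0 := h0 ▸ Ideal.height_mono hle
        rw [← maximalIdeal_height_eq_ringKrullDim, nonpos_iff_eq_zero.mp h1] at hdim
        norm_cast at hdim
    have hx3 : x ∉ maximalIdeal A ^ 2 := fun h' =>
      hx2 (Set.mem_biUnion (Set.mem_insert _ _) h')
    obtain ⟨h1, -, h2⟩ := quotient_span_singleton hx hx3
    rw [← (isRegularLocalRing_iff _).mp h1, h] at h2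
    have hdom := ih (A ⧸ Ideal.span {x}) (by exact_mod_cast h2)
    have hprime := (Ideal.Quotient.isDomain_iff_prime _).mp hdom
    obtain ⟨q, hq, hqx⟩ := Ideal.exists_minimalPrimes_le (bot_le : ⊥ ≤ Ideal.span {x})
    have hqp : q.IsPrime := hq.1.1
    have hxq : x ∉ q := fun h' => hx2 (Set.mem_biUnion (Set.mem_insert_of_mem _ hq) h')
    -- A minimal prime q ⊆ (x) with x ∉ q satisfies q = xq, so Nakayama kills it.
    have hq0 : q = ⊥ := by
      refine Submodule.eq_bot_of_le_smul_of_le_jacobson_bot (maximalIdeal A) _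
        q.fg_of_isNoetherianRing ?_ (IsLocalRing.maximalIdeal_le_jacobson _)
      intro y hy
      obtain ⟨a, rfl⟩ := Ideal.mem_span_singleton'.mp (hqx hy)
      rw [mul_comm]
      exact Ideal.mul_mem_mul hx ((hqp.mem_or_mem hy).resolve_right hxq)
    rw [hq0] at hqp
    exact IsDomain.of_bot_isPrime A

instance (priority := low) isDomain [IsRegularLocalRing A] : IsDomain A :=
  isDomain_of_spanFinrank_eq _ A rfl

/-- An element of a regular local ring which lies in the maximal ideal but not in its square
generates a prime ideal. -/
theorem isPrime_span_singleton [IsRegularLocalRing A] {x : A} (hx : x ∈ maximalIdeal A)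
    (hx2 : x ∉ maximalIdeal A ^ 2) : (Ideal.span {x}).IsPrime :=
  have := (quotient_span_singleton hx hx2).1
  (Ideal.Quotient.isDomain_iff_prime _).mp inferInstance

/-- Descent of regularity along a pure local homomorphism that maps the maximal ideal onto a
generating set of the maximal ideal. -/
theorem of_comap_map_eq {A B : Type*} [CommRing A] [CommRing B] [IsLocalRing A]
    [IsRegularLocalRing B] (f : A →+* B) (hf : ∀ J : Ideal A, (J.map f).comap f = J)
    (hmax : (maximalIdeal A).map f = maximalIdeal B) : IsRegularLocalRing A := by
  have hinj : Function.Injective (Ideal.map f) :=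
    Function.LeftInverse.injective (g := Ideal.comap f) hf
  have hNoeth : IsNoetherianRing A := by
    rw [isNoetherianRing_iff, isNoetherian_iff']
    have hmono : StrictMono (Ideal.map f) :=
      Monotone.strictMono_of_injective (fun _ _ h => Ideal.map_mono h) hinj
    exact hmono.wellFoundedGT
  have hB := (isRegularLocalRing_iff B).mp ‹_›
  -- A minimal generating set of 𝔪_B can be picked among images of elements of 𝔪_A; by purity,
  -- preimages of its members generate 𝔪_A.
  have h1 : (maximalIdeal A).spanFinrank ≤ (maximalIdeal B).spanFinrank := by
    have hmem : ∀ a : maximalIdeal A, f a ∈ maximalIdeal B := fun a =>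
      hmax ▸ Ideal.mem_map_of_mem f a.2
    let g : maximalIdeal A → maximalIdeal B := fun a => ⟨f a, hmem a⟩
    have hT : Submodule.span B (Set.range g) = ⊤ := by
      refine Submodule.map_injective_of_injective (maximalIdeal B).injective_subtype ?_
      rw [Submodule.map_span, Submodule.map_top, Submodule.range_subtype, ← Set.range_comp]
      refine Eq.trans ?_ hmax
      rw [Ideal.map, Set.image_eq_range]
      rfl
    obtain ⟨t, -, htT, hfin, hspan, hcard⟩ := exists_subset_span_eq_top hT (Set.empty_subset _)
      (linearIndepOn_empty _ _)
    obtain ⟨u, hu, huinj⟩ := Set.exists_image_eq_and_injOn (g ⁻¹' t) g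
    rw [Set.image_preimage_eq_of_subset htT] at hu
    have hufin : u.Finite := Set.Finite.of_finite_image (hu ▸ hfin) huinj
    have hum : Ideal.span ((↑) '' u : Set A) = maximalIdeal A := by
      apply hinj
      rw [hmax, ← span_image_val_eq_maximalIdeal hspan, Ideal.map_span, ← hu, Set.image_image,
        Set.image_image]
    rw [← hcard, ← hu, huinj.ncard_image]
    exact (congrArg Submodule.spanFinrank hum).symm.trans_le <|
      (Submodule.spanFinrank_span_le_ncard_of_finite (hufin.image _)).trans
        (Set.ncard_image_le hufin)
  -- If 𝔪_A is minimal over `s`, then 𝔪_B is minimal over `f(s)`: a prime containing `f(s)`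
  -- contracts to 𝔪_A, hence contains 𝔪_A B = 𝔪_B.
  have h2 : ringKrullDim B ≤ ringKrullDim A := by
    obtain ⟨s, hs, hcard⟩ :=
      Ideal.exists_finset_card_eq_height_of_isNoetherianRing (maximalIdeal A)
    classical
    rw [← maximalIdeal_height_eq_ringKrullDim, ← maximalIdeal_height_eq_ringKrullDim, ← hcard]
    refine WithBot.coe_le_coe.mpr
      ((Ideal.height_le_card_of_mem_minimalPrimes_span_finset (s := s.image f) ?_).trans
        (by exact_mod_cast Finset.card_image_le))
    refine ⟨⟨inferInstance, ?_⟩, ?_⟩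
    · rw [← hmax, Finset.coe_image, ← Ideal.map_span]
      exact Ideal.map_mono hs.1.2
    · rintro Q ⟨hQ, hsQ⟩ -
      rw [Finset.coe_image, ← Ideal.map_span, Ideal.map_le_iff_le_comap] at hsQ
      rw [← hmax, Ideal.map_le_iff_le_comap]
      exact hs.2 ⟨inferInstance, hsQ⟩ (IsLocalRing.le_maximalIdeal_of_isPrime _)
  apply of_spanFinrank_maximalIdeal_le
  refine le_trans ?_ h2
  rw [← hB]
  exact_mod_cast h1

end IsRegularLocalRing

/-! ### Descent of regularity to the degree zero part of a localization -/

namespace HomogeneousLocalization.AtPrime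

open DirectSum IsLocalRing

variable {k R : Type*} [CommRing k] [CommRing R] [Algebra k R] (𝒜 : ℕ → Submodule k R)
  [GradedAlgebra 𝒜] (p : Ideal R) [p.IsPrime]

/-- The ideal of those `x` for which every degree zero fraction, with denominator outside `p`, whose
numerator is a homogeneous multiple of a homogeneous component of `x` lies in `J`. -/
def numIdeal (J : Ideal (HomogeneousLocalization.AtPrime 𝒜 p)) : Ideal R where
  carrier := {x | ∀ i l, ∀ c ∈ 𝒜 l, ∀ s ∈ 𝒜 (i + l), ∀ hs : s ∈ p.primeCompl,
    ∃ y ∈ J, y.val = Localization.mk ((decompose 𝒜 x i : R) * c) ⟨s, hs⟩}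
  zero_mem' i l c _ s _ hs := ⟨0, J.zero_mem, by simp [Localization.mk_zero]⟩
  add_mem' := by
    intro x x' hx hx' i l c hc s hsd hs
    obtain ⟨y, hy, h⟩ := hx i l c hc s hsd hs
    obtain ⟨y', hy', h'⟩ := hx' i l c hc s hsd hs
    refine ⟨y + y', J.add_mem hy hy', ?_⟩
    rw [val_add, h, h', Localization.add_mk_self, decompose_add, DirectSum.add_apply,
      Submodule.coe_add, add_mul]
  smul_mem' := by
    intro r x hx
    change ∀ i l, ∀ c ∈ 𝒜 l, ∀ s ∈ 𝒜 (i + l), ∀ hs : s ∈ p.primeCompl,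
      ∃ y ∈ J, y.val = Localization.mk ((decompose 𝒜 (r * x) i : R) * c) ⟨s, hs⟩
    induction r using DirectSum.Decomposition.inductionOn 𝒜 with
    | zero => exact fun i l c _ s _ hs => ⟨0, J.zero_mem, by simp [Localization.mk_zero]⟩
    | @homogeneous j r =>
      intro i l c hc s hsd hs
      rw [coe_decompose_mul_of_left_mem (n := i) 𝒜 r.2]
      split_ifs with hij
      · obtain ⟨y, hy, h⟩ := hx (i - j) (j + l) (r * c) (SetLike.mul_mem_graded r.2 hc) s
          (by convert hsd using 2; omega) hs
        exact ⟨y, hy, by rw [h]; congr 1; ring⟩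
      · exact ⟨0, J.zero_mem, by simp [Localization.mk_zero]⟩
    | add r r' h h' =>
      intro i l c hc s hsd hs
      obtain ⟨y, hy, h⟩ := h i l c hc s hsd hs
      obtain ⟨y', hy', h'⟩ := h' i l c hc s hsd hs
      refine ⟨y + y', J.add_mem hy hy', ?_⟩
      rw [val_add, h, h', Localization.add_mk_self, add_mul, decompose_add, DirectSum.add_apply,
        Submodule.coe_add, add_mul]

/-- The inclusion of a homogeneous localization into the localization is pure. -/
theorem comap_map_eq (J : Ideal (HomogeneousLocalization.AtPrime 𝒜 p)) :
    (J.map (algebraMap _ (Localization.AtPrime p))).comap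
      (algebraMap (HomogeneousLocalization.AtPrime 𝒜 p) (Localization.AtPrime p)) = J := by
  classical
  refine le_antisymm ?_ Ideal.le_comap_map
  intro x hx
  have h1 : J.map (algebraMap _ (Localization.AtPrime p)) ≤
      (numIdeal 𝒜 p J).map (algebraMap R (Localization.AtPrime p)) := by
    rw [Ideal.map_le_iff_le_comap]
    intro a ha
    rw [Ideal.mem_comap, algebraMap_apply, eq_num_div_den, Localization.mk_eq_mk',
      IsLocalization.mk'_mem_map_algebraMap_iff]
    refine ⟨1, one_mem _, ?_⟩
    rw [one_mul]
    intro i l c hc s hsd hs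
    by_cases hi : a.deg = i
    · subst hi
      refine ⟨a * mk ⟨a.deg + l, ⟨a.den * c, SetLike.mul_mem_graded a.den_mem_deg hc⟩,
        ⟨s, hsd⟩, hs⟩, J.mul_mem_right _ ha, ?_⟩
      rw [val_mul, val_mk, eq_num_div_den, Localization.mk_mul,
        decompose_of_mem_same _ a.num_mem_deg, Localization.mk_eq_mk_iff, Localization.r_iff_exists]
      exact ⟨1, by simp; ring⟩
    · rw [decompose_of_mem_ne _ a.num_mem_deg hi]
      exact ⟨0, J.zero_mem, by simp [Localization.mk_zero]⟩
  have h2 := h1 hx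
  rw [algebraMap_apply, eq_num_div_den, Localization.mk_eq_mk',
      IsLocalization.mk'_mem_map_algebraMap_iff] at h2
  obtain ⟨h, hh, hmem⟩ := h2
  -- The multiplier h need not be homogeneous, but one component h_i avoids `p`; since `x.num` is
  -- homogeneous, h_i · `x.num` is a component of h · `x.num`, and dividing by h_i · `x.den`
  -- recovers `x`.
  obtain ⟨i, hi⟩ : ∃ i, (decompose 𝒜 h i : R) ∉ p := by
    by_contra! hcon
    apply hh
    rw [← DirectSum.sum_support_decompose 𝒜 h]
    exact sum_mem fun i _ => hcon i
  have hden : (decompose 𝒜 h i : R) * x.den ∈ p.primeCompl := 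
    mul_mem hi x.den_mem
  obtain ⟨y, hy, hval⟩ := hmem (i + x.deg) 0 1 SetLike.GradedOne.one_mem _
    (by simpa using SetLike.mul_mem_graded (decompose 𝒜 h i).2 x.den_mem_deg) hden
  convert hy
  apply val_injective
  rw [hval, eq_num_div_den, coe_decompose_mul_add_of_right_mem 𝒜 x.num_mem_deg,
    Localization.mk_eq_mk_iff, Localization.r_iff_exists]
  exact ⟨1, by simp; ring⟩

theorem mem_maximalIdeal_iff (x : HomogeneousLocalization.AtPrime 𝒜 p) :
    x ∈ maximalIdeal (HomogeneousLocalization.AtPrime 𝒜 p) ↔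
      x.val ∈ maximalIdeal (Localization.AtPrime p) := by
  rw [mem_maximalIdeal, mem_maximalIdeal, mem_nonunits_iff, mem_nonunits_iff,
    isUnit_iff_isUnit_val]

/-- If the homogeneous localization at a homogeneous prime ideal has a homogeneous unit of degree
one, its regularity follows from that of the localization. -/
theorem isRegularLocalRing [IsRegularLocalRing (Localization.AtPrime p)] (hp : p.IsHomogeneous 𝒜)
    {m : ℕ} {a b : R} (ha : a ∈ 𝒜 (m + 1)) (hap : a ∉ p) (hb : b ∈ 𝒜 m) (hbp : b ∉ p) :
    IsRegularLocalRing (HomogeneousLocalization.AtPrime 𝒜 p) := by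
  classical
  refine IsRegularLocalRing.of_comap_map_eq
    (algebraMap (HomogeneousLocalization.AtPrime 𝒜 p) (Localization.AtPrime p))
    (comap_map_eq 𝒜 p) (le_antisymm ?_ ?_)
  · rw [Ideal.map_le_iff_le_comap]
    exact fun x hx => (mem_maximalIdeal_iff 𝒜 p x).mp hx
  · rw [← Localization.AtPrime.map_eq_maximalIdeal, Ideal.map_le_iff_le_comap]
    intro f hf
    rw [← DirectSum.sum_support_decompose 𝒜 f]
    refine sum_mem fun i _ => ?_
    have hak : a ^ i ∈ p.primeCompl := pow_mem (show _ ∈ p.primeCompl from hap) i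
    -- b/a is a unit of degree -1, so f_i (b/a)^i has degree zero and is associated to f_i in the
    -- full localization.
    let y : HomogeneousLocalization.AtPrime 𝒜 p := mk ⟨i + i * m,
      ⟨(decompose 𝒜 f i : R) * b ^ i,
        SetLike.mul_mem_graded (decompose 𝒜 f i).2 (SetLike.pow_mem_graded i hb)⟩,
      ⟨a ^ i, by convert SetLike.pow_mem_graded i ha using 2; simp; ring⟩, hak⟩
    have hy : y ∈ maximalIdeal _ := by
      rw [mem_maximalIdeal_iff, val_mk, Localization.mk_eq_mk',
        IsLocalization.AtPrime.mk'_mem_maximal_iff _ p]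
      exact p.mul_mem_right _ (hp i hf)
    have hbi : b ^ i ∈ p.primeCompl := pow_mem (show _ ∈ p.primeCompl from hbp) i
    rw [Ideal.mem_comap]
    convert Ideal.mul_mem_right (Localization.mk (a ^ i) ⟨b ^ i, hbi⟩) _
      (Ideal.mem_map_of_mem (algebraMap (HomogeneousLocalization.AtPrime 𝒜 p)
        (Localization.AtPrime p)) hy)
    rw [algebraMap_apply, val_mk, Localization.mk_mul, ← Localization.mk_one_eq_algebraMap,
      Localization.mk_eq_mk_iff, Localization.r_iff_exists]
    exact ⟨1, by simp; ring⟩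

end HomogeneousLocalization.AtPrime

/-! ### Degrees of homogeneous elements outside a prime -/

namespace WeightedProj

section Degrees

variable {k A : Type*} [CommRing k] [CommRing A] [Algebra k A]

/-- The degrees in which some homogeneous element lies outside `I`. -/
def degreesOutside (𝒜 : ℕ → Submodule k A) (I : Ideal A) : Set ℕ :=
  {d | ∃ a ∈ 𝒜 d, a ∉ I}

theorem saturationIndex_quotientGrading (𝒜 : ℕ → Submodule k A) (I : Ideal A) :
    saturationIndex (quotientGrading 𝒜 I) = Nat.setGcd (degreesOutside 𝒜 I) := by
  unfold saturationIndex
  congr 1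
  ext d
  rw [Set.mem_ofPred_eq, Submodule.ne_bot_iff]
  constructor
  · rintro ⟨_, ⟨a, ha, rfl⟩, h⟩
    exact ⟨a, ha, fun haI => h (Ideal.Quotient.eq_zero_iff_mem.mpr haI)⟩
  · rintro ⟨a, ha, h⟩
    exact ⟨_, ⟨a, ha, rfl⟩, fun h0 => h (Ideal.Quotient.eq_zero_iff_mem.mp h0)⟩

theorem degreesOutside_quotientGrading (𝒜 : ℕ → Submodule k A) (I : Ideal A) (P : Ideal (A ⧸ I)) :
    degreesOutside (quotientGrading 𝒜 I) P =
      degreesOutside 𝒜 (P.comap (Ideal.Quotient.mk I)) := by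
  ext d
  simp [degreesOutside, quotientGrading]

variable (𝒜 : ℕ → Submodule k A) [SetLike.GradedMonoid 𝒜]

/-- Primality makes these degrees a numerical semigroup, which contains all large multiples of its
gcd. -/
theorem exists_notMem_of_ge (p : Ideal A) [p.IsPrime] : ∃ N₀, ∀ N ≥ N₀,
    Nat.setGcd (degreesOutside 𝒜 p) ∣ N → ∃ a ∈ 𝒜 N, a ∉ p := by
  obtain ⟨N₀, h⟩ := Nat.exists_mem_closure_of_ge (degreesOutside 𝒜 p)
  refine ⟨N₀, fun N hN hd => ?_⟩
  have hmem := h N hN hd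
  clear hN hd
  induction hmem using AddSubmonoid.closure_induction with
  | mem x hx => exact hx
  | zero => exact ⟨1, SetLike.GradedOne.one_mem, p.one_notMem⟩
  | add x y _ _ hx hy =>
    obtain ⟨a, ha, hap⟩ := hx
    obtain ⟨b, hb, hbp⟩ := hy
    exact ⟨a * b, SetLike.mul_mem_graded ha hb, fun h =>
      (Ideal.IsPrime.mem_or_mem ‹_› h).elim hap hbp⟩

end Degrees

/-! ### Regular points, and expansion along a variable -/

section Regular

variable {n : ℕ} (w : Fin (n + 1) → ℕ)

open MvPolynomial IsLocalRing

theorem X_mem_grading (i : Fin (n + 1)) : (X i : MvPolynomial (Fin (n + 1)) ℂ) ∈ grading w (w i) :=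
  (mem_weightedHomogeneousSubmodule _ _ _ _).mpr (isWeightedHomogeneous_X ℂ w i)

theorem isRegularLocalRing_atPrime (p : Ideal (MvPolynomial (Fin (n + 1)) ℂ)) [p.IsPrime]
    (hp : p.IsHomogeneous (grading w)) (hd : Nat.setGcd (degreesOutside (grading w) p) = 1) :
    IsRegularLocalRing (HomogeneousLocalization.AtPrime (grading w) p) := by
  obtain ⟨N, hN⟩ := exists_notMem_of_ge (grading w) p
  obtain ⟨a, ha, hap⟩ := hN (N + 1) (by omega) (by simp [hd])
  obtain ⟨b, hb, hbp⟩ := hN N le_rfl (by simp [hd])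
  exact HomogeneousLocalization.AtPrime.isRegularLocalRing _ p hp ha hap hb hbp

section Singular

variable (p : Ideal (MvPolynomial (Fin (n + 1)) ℂ)) [p.IsPrime] (j : Fin (n + 1))

/-- The expansion of a polynomial as a power series in the variable `X j` over the residue field
of `p`. -/
noncomputable def expandAt : MvPolynomial (Fin (n + 1)) ℂ →+* PowerSeries p.ResidueField :=
  eval₂Hom (PowerSeries.C.comp ((algebraMap (MvPolynomial (Fin (n + 1)) ℂ) p.ResidueField).comp C))
    (fun i => if i = j then PowerSeries.X else
      PowerSeries.C (algebraMap (MvPolynomial (Fin (n + 1)) ℂ) p.ResidueField (X i)))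

variable {p j}

/-- The constant term is obtained by setting X_j to zero, which is already its class modulo `p`.
Thus elements outside `p` expand to units. -/
theorem constantCoeff_expandAt (hj : X j ∈ p) (F : MvPolynomial (Fin (n + 1)) ℂ) :
    PowerSeries.constantCoeff (expandAt p j F) = algebraMap _ p.ResidueField F := by
  suffices h : (PowerSeries.constantCoeff).comp (expandAt p j) = algebraMap _ p.ResidueField from
    congr($h F)
  apply MvPolynomial.ringHom_ext
  · simp [expandAt]
  · intro i
    by_cases h : i = j
    · subst h
      simp [expandAt, Ideal.algebraMap_residueField_eq_zero.mpr hj]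
    · simp [expandAt, h]

theorem isUnit_expandAt (hj : X j ∈ p) {F : MvPolynomial (Fin (n + 1)) ℂ} (hF : F ∉ p) :
    IsUnit (expandAt p j F) := by
  rw [PowerSeries.isUnit_iff_constantCoeff, constantCoeff_expandAt hj, isUnit_iff_ne_zero, ne_eq,
    Ideal.algebraMap_residueField_eq_zero]
  exact hF

theorem expandAt_monomial (α : Fin (n + 1) →₀ ℕ) (c : ℂ) :
    expandAt p j (monomial α c) = PowerSeries.X ^ α j *
      PowerSeries.C (algebraMap _ p.ResidueField (monomial (α.erase j) c)) := by
  have h1 : monomial α c = X j ^ α j * monomial (α.erase j) c := by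
    rw [X_pow_eq_monomial, monomial_mul, Finsupp.single_add_erase, one_mul]
  have h2 : ∀ β : Fin (n + 1) →₀ ℕ, β j = 0 → expandAt p j (monomial β c) =
      PowerSeries.C (algebraMap _ p.ResidueField (monomial β c)) := by
    intro β hβ
    rw [expandAt, coe_eval₂Hom, eval₂_monomial, monomial_eq, map_mul, map_mul, Finsupp.prod,
      Finsupp.prod, map_prod, map_prod]
    congr 1
    refine Finset.prod_congr rfl fun i hi => ?_
    have : i ≠ j := by
      rintro rfl
      exact Finsupp.mem_support_iff.mp hi hβ
    simp [this]
  rw [h1, map_mul, h2 _ (by simp), map_pow]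
  simp [expandAt]

/-- If a homogeneous element of degree divisible by all degrees of homogeneous elements outside `p`
lies in `p`, the order of its expansion at `X j` is at least `e`. -/
theorem X_pow_dvd_expandAt (hj : X j ∈ p) {e : ℕ}
    (he : ∀ m ≠ 0, Nat.setGcd (degreesOutside (grading w) p) ∣ m * w j → e ≤ m)
    {D : ℕ} (hD : Nat.setGcd (degreesOutside (grading w) p) ∣ D)
    {F : MvPolynomial (Fin (n + 1)) ℂ} (hF : F ∈ grading w D) (hFp : F ∈ p) :
    PowerSeries.X ^ e ∣ expandAt p j F := by
  have key : PowerSeries.X ^ e ∣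
      expandAt p j F - PowerSeries.C (algebraMap _ p.ResidueField F) := by
    rw [F.as_sum, map_sum, map_sum, map_sum, ← Finset.sum_sub_distrib]
    refine Finset.dvd_sum fun α hα => ?_
    rw [expandAt_monomial]
    by_cases h0 : α j = 0
    · rw [h0, pow_zero, one_mul, Finsupp.erase_of_notMem_support (by simpa using h0), sub_self]
      exact dvd_zero _
    · have h1 : algebraMap _ p.ResidueField (monomial α (coeff α F)) = 0 := by
        rw [Ideal.algebraMap_residueField_eq_zero, ← Finsupp.single_add_erase j α,
          ← one_mul (coeff _ F), ← monomial_mul, ← X_pow_eq_monomial]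
        exact p.mul_mem_right _ (p.pow_mem_of_mem hj _ (Nat.pos_of_ne_zero h0))
      rw [h1, map_zero, sub_zero]
      by_cases h2 : monomial (α.erase j) (coeff α F) ∈ p
      · rw [Ideal.algebraMap_residueField_eq_zero.mpr h2, map_zero, mul_zero]
        exact dvd_zero _
      -- The cofactor of X_j^m lies outside `p`, so the gcd divides its degree; dividing D too, it
      -- divides m w_j, whence m ≥ e.
      · refine Dvd.dvd.mul_right (pow_dvd_pow _ (he _ h0 ?_)) _
        have h3 : Finsupp.weight w (α.erase j) ∈ degreesOutside (grading w) p :=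
          ⟨_, (mem_weightedHomogeneousSubmodule _ _ _ _).mpr
            (isWeightedHomogeneous_monomial w _ _ rfl), h2⟩
        have h4 : Finsupp.weight w α = D := hF (mem_support_iff.mp hα)
        rw [← Finsupp.single_add_erase j α, map_add, Finsupp.weight_single, smul_eq_mul] at h4
        rw [← h4] at hD
        exact (Nat.dvd_add_left (Nat.setGcd_dvd_of_mem h3)).mp hD
  rwa [Ideal.algebraMap_residueField_eq_zero.mpr hFp, map_zero, sub_zero] at key

end Singular

end Regular

end WeightedProj

/-! ### Singular points -/

namespace WeightedProj

section NotRegular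

open MvPolynomial IsLocalRing

variable {n : ℕ} {w : Fin (n + 1) → ℕ} {p : Ideal (MvPolynomial (Fin (n + 1)) ℂ)} [p.IsPrime]
  {j : Fin (n + 1)}

variable (p j) in
/-- The extension of `expandAt` to the localization at `p`. -/
noncomputable def expandLocalization (hj : X j ∈ p) :
    Localization.AtPrime p →+* PowerSeries p.ResidueField :=
  IsLocalization.lift (M := p.primeCompl) (g := expandAt p j) fun G => isUnit_expandAt hj G.2

theorem expandLocalization_mk (hj : X j ∈ p) (F : MvPolynomial (Fin (n + 1)) ℂ)
    (G : p.primeCompl) :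
    expandAt p j G * expandLocalization p j hj (Localization.mk F G) = expandAt p j F := by
  rw [Localization.mk_eq_mk']
  exact ((IsLocalization.lift_mk'_spec (fun G : p.primeCompl => isUnit_expandAt hj G.2)
    F _ G).mp rfl).symm

/-- The maximal ideal of the homogeneous localization at `p` consists of fractions whose expansion
at `X j` has order at least `e`. -/
theorem maximalIdeal_le_comap_expandLocalization (hj : X j ∈ p) {e : ℕ}
    (he : ∀ m ≠ 0, Nat.setGcd (degreesOutside (grading w) p) ∣ m * w j → e ≤ m) :
    maximalIdeal (HomogeneousLocalization.AtPrime (grading w) p) ≤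
      (Ideal.span {PowerSeries.X ^ e}).comap
        ((expandLocalization p j hj).comp (algebraMap _ _)) := by
  intro x hx
  rw [HomogeneousLocalization.AtPrime.mem_maximalIdeal_iff,
    HomogeneousLocalization.eq_num_div_den, Localization.mk_eq_mk',
    IsLocalization.AtPrime.mk'_mem_maximal_iff _ p] at hx
  rw [Ideal.mem_comap, Ideal.mem_span_singleton, RingHom.comp_apply,
    HomogeneousLocalization.algebraMap_apply, HomogeneousLocalization.eq_num_div_den,
    ← (isUnit_expandAt hj x.den_mem).dvd_mul_left,
    expandLocalization_mk hj x.num ⟨x.den, x.den_mem⟩]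
  exact X_pow_dvd_expandAt w hj he
    (Nat.setGcd_dvd_of_mem ⟨x.den, x.den_mem_deg, x.den_mem⟩) x.num_mem_deg hx

/-- Elements of the square have X_j-order at least 2e, whereas `u` has order exactly e. -/
theorem notMem_maximalIdeal_sq (hj : X j ∈ p) {e : ℕ} (he0 : e ≠ 0)
    (he : ∀ m ≠ 0, Nat.setGcd (degreesOutside (grading w) p) ∣ m * w j → e ≤ m)
    (u : HomogeneousLocalization.AtPrime (grading w) p) {B C : MvPolynomial (Fin (n + 1)) ℂ}
    (hB : B ∉ p) (hC : C ∈ p.primeCompl)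
    (hu : u.val = Localization.mk (X j ^ e * B) ⟨C, hC⟩) :
    u ∉ maximalIdeal (HomogeneousLocalization.AtPrime (grading w) p) ^ 2 := by
  intro h
  have h1 := Ideal.le_comap_pow _ 2 (Ideal.pow_right_mono
    (maximalIdeal_le_comap_expandLocalization hj he) 2 h)
  rw [Ideal.mem_comap, Ideal.span_singleton_pow, Ideal.mem_span_singleton, RingHom.comp_apply,
    HomogeneousLocalization.algebraMap_apply, hu, ← (isUnit_expandAt hj hC).dvd_mul_left,
    expandLocalization_mk hj _ ⟨C, hC⟩, map_mul, map_pow, pow_two] at h1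
  have h3 : expandAt p j (X j) = PowerSeries.X := by simp [expandAt]
  rw [h3, mul_dvd_mul_iff_left (pow_ne_zero _ PowerSeries.X_ne_zero)] at h1
  have h4 := (dvd_pow_self _ he0).trans h1
  rw [PowerSeries.X_dvd_iff, constantCoeff_expandAt hj, Ideal.algebraMap_residueField_eq_zero] at h4
  exact hB h4

/-- The variables other than X_j lie outside (X_j), and their weights have gcd one. This provides
numerators prime to X_j in every large degree. -/
theorem setGcd_degreesOutside_span_X (hw : WellFormedTuple w) (j : Fin (n + 1)) :
    Nat.setGcd (degreesOutside (grading w) (Ideal.span {X j})) = 1 := by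
  refine Nat.dvd_one.mp ((Finset.dvd_gcd fun i hi => Nat.setGcd_dvd_of_mem ?_).trans (hw j).dvd)
  refine ⟨X i, X_mem_grading w i, fun h => (Finset.mem_erase.mp hi).1 ?_⟩
  rw [Ideal.mem_span_singleton, X_dvd_X] at h
  exact h.symm

/-- The local ring of a well-formed weighted projective space at a point is not regular if the
degrees of the homogeneous elements not vanishing there have a common divisor. -/
theorem not_isRegularLocalRing_atPrime (hw : WellFormedTuple w)
    (h0 : Nat.setGcd (degreesOutside (grading w) p) ≠ 0)
    (h1 : Nat.setGcd (degreesOutside (grading w) p) ≠ 1) :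
    ¬ IsRegularLocalRing (HomogeneousLocalization.AtPrime (grading w) p) := by
  intro hreg
  set d := Nat.setGcd (degreesOutside (grading w) p) with hd
  obtain ⟨j, hdj⟩ : ∃ j, ¬ d ∣ w j := by
    by_contra! h
    exact h1 (Nat.dvd_one.mp ((Finset.dvd_gcd fun i _ => h i).trans (hw 0).dvd))
  have hj : X j ∈ p := by
    by_contra h
    exact hdj (Nat.setGcd_dvd_of_mem ⟨X j, X_mem_grading w j, h⟩)
  have hex : ∃ m, m ≠ 0 ∧ d ∣ m * w j := ⟨d, h0, dvd_mul_right _ _⟩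
  classical
  obtain ⟨e, ⟨he0, hde⟩, he⟩ : ∃ e, (e ≠ 0 ∧ d ∣ e * w j) ∧ ∀ m ≠ 0, d ∣ m * w j → e ≤ m :=
    ⟨Nat.find hex, Nat.find_spec hex, fun m hm hdm => Nat.find_min' hex ⟨hm, hdm⟩⟩
  have he1 : e ≠ 1 := by
    rintro rfl
    exact hdj (by simpa using hde)
  obtain ⟨N₀, hN₀⟩ := exists_notMem_of_ge (grading w) p
  have hprime : (Ideal.span {(X j : MvPolynomial (Fin (n + 1)) ℂ)}).IsPrime :=
    (Ideal.span_singleton_prime (X_ne_zero j)).mpr (X_prime)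
  obtain ⟨N₁, hN₁⟩ := exists_notMem_of_ge (grading w) (Ideal.span {X j})
  obtain ⟨B, hBd, hB⟩ := hN₀ (d * N₀) (Nat.le_mul_of_pos_left _ (by omega)) (dvd_mul_right _ _)
  obtain ⟨C, hCd, hC⟩ := hN₀ (e * w j + d * N₀)
    (Nat.le_add_left_of_le (Nat.le_mul_of_pos_left _ (by omega)))
    ((Nat.dvd_add_right hde).mpr (dvd_mul_right _ _))
  -- The multiple M of d is large enough for a denominator `C'` of degree M and for `V` of degree M
  -- - w_j, so that X_j V / C' has degree zero.
  have hle : N₀ + N₁ + w j ≤ d * (N₀ + N₁ + w j) := Nat.le_mul_of_pos_left _ (by omega)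
  obtain ⟨V, hVd, hV⟩ := hN₁ (d * (N₀ + N₁ + w j) - w j) (by omega)
    (by rw [setGcd_degreesOutside_span_X hw]; exact one_dvd _)
  obtain ⟨C', hCd', hC'⟩ := hN₀ (d * (N₀ + N₁ + w j)) (by omega) (dvd_mul_right _ _)
  set M := d * (N₀ + N₁ + w j) with hM
  have hXe := SetLike.pow_mem_graded e (X_mem_grading w j)
  let u : HomogeneousLocalization.AtPrime (grading w) p := .mk ⟨e * w j + d * N₀,
    ⟨X j ^ e * B, SetLike.mul_mem_graded hXe hBd⟩, ⟨C, hCd⟩, hC⟩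
  let v : HomogeneousLocalization.AtPrime (grading w) p := .mk ⟨M,
    ⟨X j * V, by
      have := SetLike.mul_mem_graded (X_mem_grading w j) hVd
      rwa [Nat.add_sub_cancel' (by omega)] at this⟩, ⟨C', hCd'⟩, hC'⟩
  have hdeg : e * (M - w j) + (e * w j + d * N₀) = e * M + d * N₀ := by
    rw [← add_assoc, ← mul_add, Nat.sub_add_cancel (by omega)]
  let y : HomogeneousLocalization.AtPrime (grading w) p := .mk ⟨e * M + d * N₀,
    ⟨V ^ e * C, hdeg ▸ SetLike.mul_mem_graded (SetLike.pow_mem_graded e hVd) hCd⟩,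
    ⟨C' ^ e * B, SetLike.mul_mem_graded (SetLike.pow_mem_graded e hCd') hBd⟩,
    mul_mem (pow_mem (show C' ∈ p.primeCompl from hC') e) hB⟩
  have hvu : v ^ e = u * y := by
    apply HomogeneousLocalization.val_injective
    rw [HomogeneousLocalization.val_pow, HomogeneousLocalization.val_mul,
      HomogeneousLocalization.val_mk, HomogeneousLocalization.val_mk,
      HomogeneousLocalization.val_mk, Localization.mk_mul, Localization.mk_pow,
      Localization.mk_eq_mk_iff, Localization.r_iff_exists]
    exact ⟨1, by simp; ring⟩
  have hum : u ∈ maximalIdeal _ := by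
    rw [HomogeneousLocalization.AtPrime.mem_maximalIdeal_iff, HomogeneousLocalization.val_mk,
      Localization.mk_eq_mk', IsLocalization.AtPrime.mk'_mem_maximal_iff _ p]
    exact p.mul_mem_right _ (p.pow_mem_of_mem hj _ (Nat.pos_of_ne_zero he0))
  have hup := IsRegularLocalRing.isPrime_span_singleton hum
    (notMem_maximalIdeal_sq hj he0 he u hB hC (HomogeneousLocalization.val_mk _))
  have hvmem : v ∈ Ideal.span {u} := by
    refine hup.mem_of_pow_mem e ?_
    rw [hvu]
    exact Ideal.mul_mem_right _ _ (Ideal.mem_span_singleton_self u)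
  obtain ⟨z, hz⟩ := Ideal.mem_span_singleton'.mp hvmem
  have hz := congrArg HomogeneousLocalization.val hz
  rw [HomogeneousLocalization.val_mul, HomogeneousLocalization.eq_num_div_den,
    HomogeneousLocalization.val_mk, HomogeneousLocalization.val_mk, Localization.mk_mul,
    Localization.mk_eq_mk_iff, Localization.r_iff_exists] at hz
  obtain ⟨c, hc⟩ := hz
  have hc0 : (c : MvPolynomial (Fin (n + 1)) ℂ) ≠ 0 := fun h => c.2 (h ▸ p.zero_mem)
  have hc := mul_left_cancel₀ hc0 hc
  -- As e ≥ 2, cancelling one X_j in v = zu leaves X_j dividing `z.den * C * V`, none of whose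
  -- factors it divides.
  obtain ⟨f, rfl⟩ : ∃ f, e = f + 2 := ⟨e - 2, by omega⟩
  have hdvd : X j * (X j * (C' * z.num * X j ^ f * B)) = X j * (z.den * C * V) := by
    simp only [Submonoid.coe_mul] at hc
    linear_combination hc
  have hdvd := (mul_left_cancel₀ (X_ne_zero j) hdvd) ▸ dvd_mul_right _ _
  have hpX : Ideal.span {X j} ≤ p := (Ideal.span_singleton_le_iff_mem _).mpr hj
  rw [← Ideal.mem_span_singleton] at hdvd
  rcases hprime.mem_or_mem hdvd with h | h
  · rcases hprime.mem_or_mem h with h | h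
    · exact z.den_mem (hpX h)
    · exact hC (hpX h)
  · exact hV h

end NotRegular

end WeightedProj

/-! ### Dimension theory of polynomial rings and graded quotients -/

namespace WeightedProj

section Dimension

open MvPolynomial DirectSum

/-- Induction on the variables: over a Jacobson ring a maximal ideal contracts to a maximal ideal,
and each new variable adds one to the height. -/
theorem height_eq_natCard_of_isMaximal {K : Type*} [Field K] {ι : Type*} [Finite ι]
    (M : Ideal (MvPolynomial ι K)) [M.IsMaximal] : M.height = Nat.card ι := by
  induction ι using Finite.induction_empty_option with
  | of_equiv e ih =>
    have := ih (M.comap (renameEquiv K e).toRingEquiv)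
    rw [RingEquiv.height_comap] at this
    rw [this, Nat.card_congr e]
  | h_empty =>
    have h := Ideal.height_le_ringKrullDim_of_ne_top (I := M) Ideal.IsPrime.ne_top'
    rw [MvPolynomial.ringKrullDim_of_isNoetherianRing] at h
    simpa using h
  | @h_option ι _ ih =>
    let e := (optionEquivLeft K ι).symm.toRingEquiv
    have hM : (M.comap e).IsMaximal := Ideal.comap_isMaximal_of_equiv e
    rw [← RingEquiv.height_comap e]
    generalize (M.comap e : Ideal (Polynomial (MvPolynomial ι K))) = P at hM
    have h1 : (P.comap Polynomial.C).IsMaximal := Polynomial.isMaximal_comap_C_of_isJacobsonRing P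
    have : P.LiesOver (P.comap Polynomial.C) := ⟨rfl⟩
    rw [Polynomial.height_eq_height_add_one (P.comap Polynomial.C) P, ih]
    simp

/-- Contraction along an integral map is strict on chains of primes, and `K[T]` has dimension one.
-/
theorem not_lt_and_lt_of_isIntegral {K B : Type*} [Field K] [CommRing B] (φ : Polynomial K →+* B)
    (hφ : φ.IsIntegral) {P Q M : Ideal B} [P.IsPrime] [Q.IsPrime] [M.IsPrime] (hPQ : P < Q) :
    ¬ Q < M := by
  intro hQM
  let _ := φ.toAlgebra
  have : Algebra.IsIntegral (Polynomial K) B := ⟨hφ⟩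
  have h1 := Ideal.IsIntegral.comap_lt_comap (R := Polynomial K) hPQ
  have h2 := Ideal.IsIntegral.comap_lt_comap (R := Polynomial K) hQM
  have h3 : (Q.comap (algebraMap (Polynomial K) B)).IsMaximal :=
    IsPrime.to_maximal_ideal (bot_le.trans_lt h1).ne'
  exact (Ideal.comap_isPrime (algebraMap (Polynomial K) B) M).ne_top (h3.1.2 _ h2)

variable {n : ℕ} {w : Fin (n + 1) → ℕ}

theorem exists_eq_C_of_mem_grading_zero (hw_pos : ∀ i, 0 < w i)
    {F : MvPolynomial (Fin (n + 1)) ℂ} (hF : F ∈ grading w 0) : ∃ c, F = C c := by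
  refine ⟨coeff 0 F, ?_⟩
  ext α
  rw [coeff_C]
  split_ifs with h
  · rw [h]
  · by_contra h0
    have h1 : Finsupp.weight w α = 0 := hF h0
    obtain ⟨i, hi⟩ := Finsupp.ne_iff.mp (Ne.symm h)
    have h2 := Finsupp.le_weight w (hw_pos i).ne' α
    rw [h1] at h2
    exact hi (by simpa using h2)

theorem ne_zero_of_mem_grading (hw_pos : ∀ i, 0 < w i) {d : ℕ}
    {F : MvPolynomial (Fin (n + 1)) ℂ} (hF : F ∈ grading w d) (hF0 : F ≠ 0)
    {Q : Ideal (MvPolynomial (Fin (n + 1)) ℂ)} (hQ : Q ≠ ⊤) (hFQ : F ∈ Q) : d ≠ 0 := by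
  rintro rfl
  obtain ⟨c, rfl⟩ := exists_eq_C_of_mem_grading_zero hw_pos hF
  refine hQ (Q.eq_top_of_isUnit_mem hFQ (IsUnit.map _ (isUnit_iff_ne_zero.mpr ?_)))
  rintro rfl
  exact hF0 C.map_zero

/-- An ideal that contains all variables contains every proper homogeneous ideal. -/
theorem le_of_forall_X_mem (hw_pos : ∀ i, 0 < w i) {p Q : Ideal (MvPolynomial (Fin (n + 1)) ℂ)}
    (hp : ∀ i, X i ∈ p) (hQ : Q.IsHomogeneous (grading w)) (hQtop : Q ≠ ⊤) : Q ≤ p := by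
  classical
  intro F hF
  rw [← DirectSum.sum_support_decompose (grading w) F]
  refine sum_mem fun d _ => ?_
  have hFd := hQ d hF
  have hd := (decompose (grading w) F d).2
  generalize (decompose (grading w) F d : MvPolynomial (Fin (n + 1)) ℂ) = G at hFd hd
  by_cases hG : G = 0
  · rw [hG]
    exact p.zero_mem
  have hd0 := ne_zero_of_mem_grading hw_pos hd hG hQtop hFd
  rw [G.as_sum]
  refine sum_mem fun α hα => ?_
  have h1 : Finsupp.weight w α = d := hd (mem_support_iff.mp hα)
  obtain ⟨i, hi⟩ : ∃ i, α i ≠ 0 := by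
    by_contra! h
    have h2 : α = 0 := Finsupp.ext h
    rw [h2, map_zero] at h1
    exact hd0 h1.symm
  rw [← Finsupp.single_add_erase i α, ← one_mul (coeff _ G), ← monomial_mul, ← X_pow_eq_monomial]
  exact p.mul_mem_right _ (p.pow_mem_of_mem (hp i) _ (Nat.pos_of_ne_zero hi))

/-- If the variables are nilpotent modulo `I` and a homogeneous element `f`, then the quotient
modulo `I` is integral over the polynomials in `f`. -/
theorem isIntegral_aeval_of_X_mem_radical {I : Ideal (MvPolynomial (Fin (n + 1)) ℂ)}
    (hI : I.IsHomogeneous (grading w)) {d : ℕ} (hd : d ≠ 0) {f : MvPolynomial (Fin (n + 1)) ℂ}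
    (hf : f ∈ grading w d) (hX : ∀ i, X i ∈ (I ⊔ Ideal.span {f}).radical) :
    (Polynomial.aeval (R := ℂ) (Ideal.Quotient.mk I f)).toRingHom.IsIntegral := by
  -- Taking the component of degree N w_i; the second alternative is the case N w_i < d, where f g
  -- has no such component.
  have h1 : ∀ i, ∃ N, ∃ g, (X i ^ N - f * g ∈ I ∧ d ≤ N * w i ∧ g ∈ grading w (N * w i - d)) ∨
      X i ^ N ∈ I := by
    intro i
    obtain ⟨N, hN⟩ := hX i
    obtain ⟨a, ha, b, hb, hab⟩ := Submodule.mem_sup.mp hN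
    obtain ⟨g, rfl⟩ := Ideal.mem_span_singleton'.mp hb
    refine ⟨N, decompose (grading w) g (N * w i - d), ?_⟩
    have hXN := SetLike.pow_mem_graded N (X_mem_grading w i)
    rw [smul_eq_mul] at hXN
    have h2 := hI (N * w i) ha
    rw [eq_sub_of_add_eq hab, decompose_sub, DirectSum.sub_apply, Submodule.coe_sub,
      decompose_of_mem_same _ hXN, mul_comm g f,
      coe_decompose_mul_of_left_mem (n := N * w i) _ hf] at h2
    split_ifs at h2 with hle
    · exact .inl ⟨h2, hle, (decompose (grading w) g _).2⟩
    · exact .inr (by simpa using h2)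
  choose N g hg using h1
  let φ := (Polynomial.aeval (R := ℂ) (Ideal.Quotient.mk I f)).toRingHom
  let _ := φ.toAlgebra
  let β : Fin (n + 1) →₀ ℕ := Finsupp.equivFunOnFinite.symm N
  let S : Set (MvPolynomial (Fin (n + 1)) ℂ ⧸ I) :=
    (fun α => Ideal.Quotient.mk I (monomial α 1)) '' Set.Iic β
  -- Induction on weight: a factor X_i^(N_i) is traded for f · g_i, and the remaining cofactor has
  -- smaller weight because d > 0.
  have key : ∀ D, ∀ F ∈ grading w D,
      Ideal.Quotient.mk I F ∈ Submodule.span (Polynomial ℂ) S := by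
    intro D
    induction D using Nat.strong_induction_on with
    | _ D ih =>
      intro F hF
      rw [F.as_sum, map_sum]
      refine sum_mem fun α hα => ?_
      have hα : Finsupp.weight w α = D := hF (mem_support_iff.mp hα)
      generalize coeff α F = c
      by_cases h : α ≤ β
      · have : Ideal.Quotient.mk I (monomial α c) =
            (Polynomial.C c : Polynomial ℂ) • Ideal.Quotient.mk I (monomial α 1) := by
          rw [Algebra.smul_def]
          change _ = Polynomial.aeval (R := ℂ) (Ideal.Quotient.mk I f) (Polynomial.C c) * _
          rw [Polynomial.aeval_C, ← mul_one c, ← smul_eq_mul, ← smul_monomial, smul_eq_mul, mul_one,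
            MvPolynomial.smul_eq_C_mul, map_mul]
          rfl
        rw [this]
        exact Submodule.smul_mem _ _ (Submodule.subset_span ⟨α, h, rfl⟩)
      · obtain ⟨i, hi⟩ : ∃ i, N i ≤ α i := by
          by_contra! hcon
          exact h fun i => (hcon i).le
        obtain ⟨γ, rfl⟩ : ∃ γ, α = Finsupp.single i (N i) + γ :=
          ⟨α - Finsupp.single i (N i), (add_tsub_cancel_of_le (by simpa using hi)).symm⟩
        rw [map_add, Finsupp.weight_single, smul_eq_mul] at hα
        have hmon : (monomial (Finsupp.single i (N i) + γ) c : MvPolynomial (Fin (n + 1)) ℂ) =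
            X i ^ N i * monomial γ c := by
          rw [X_pow_eq_monomial, monomial_mul, one_mul]
        rcases hg i with ⟨h1, hle, hgi⟩ | h1
        · have h2 : Ideal.Quotient.mk I (monomial (Finsupp.single i (N i) + γ) c) =
              (Polynomial.X : Polynomial ℂ) • Ideal.Quotient.mk I (g i * monomial γ c) := by
            rw [Algebra.smul_def]
            change _ = Polynomial.aeval (R := ℂ) (Ideal.Quotient.mk I f) Polynomial.X * _
            rw [Polynomial.aeval_X, hmon, ← map_mul, Ideal.Quotient.mk_eq_mk_iff_sub_mem]
            convert I.mul_mem_right (monomial γ c) h1 using 1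
            ring
          rw [h2]
          refine Submodule.smul_mem _ _ (ih (N i * w i - d + Finsupp.weight w γ) (by omega) _
            (SetLike.mul_mem_graded hgi ((mem_weightedHomogeneousSubmodule _ _ _ _).mpr
              (isWeightedHomogeneous_monomial w _ _ rfl))))
        · rw [hmon, Ideal.Quotient.eq_zero_iff_mem.mpr (I.mul_mem_right _ h1)]
          exact zero_mem _
  have htop : Submodule.span (Polynomial ℂ) S = ⊤ := by
    classical
    refine eq_top_iff.mpr fun b _ => ?_
    obtain ⟨F, rfl⟩ := Ideal.Quotient.mk_surjective b
    rw [← DirectSum.sum_support_decompose (grading w) F, map_sum]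
    exact sum_mem fun D _ => key D _ (decompose (grading w) F D).2
  have : Module.Finite (Polynomial ℂ) (MvPolynomial (Fin (n + 1)) ℂ ⧸ I) :=
    ⟨htop ▸ Submodule.fg_span ((Set.finite_Iic β).image _)⟩
  exact (Algebra.IsIntegral.of_finite (Polynomial ℂ) (MvPolynomial (Fin (n + 1)) ℂ ⧸ I)).isIntegral

end Dimension

end WeightedProj

/-! ### Homogeneous primes of height one in the quotient -/

namespace WeightedProj

section Quotient

open DirectSum

variable {k A : Type*} [CommRing k] [CommRing A] [Algebra k A] {𝒜 : ℕ → Submodule k A}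
  [GradedAlgebra 𝒜] {I : HomogeneousIdeal 𝒜}

theorem coe_decompose_mk (a : A) (i : ℕ) :
    (decompose (quotientGrading 𝒜 I.toIdeal) (Ideal.Quotient.mk I.toIdeal a) i : A ⧸ I.toIdeal) =
      Ideal.Quotient.mk I.toIdeal (decompose 𝒜 a i) := by
  induction a using DirectSum.Decomposition.inductionOn 𝒜 with
  | zero => simp
  | @homogeneous j a =>
    by_cases h : j = i
    · subst h
      rw [decompose_of_mem_same _ a.2, decompose_of_mem_same _ (mk_mem_quotientGrading _ a.2)]
    · rw [decompose_of_mem_ne _ a.2 h, decompose_of_mem_ne _ (mk_mem_quotientGrading _ a.2) h,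
        map_zero]
  | add a b ha hb =>
    rw [map_add, decompose_add, decompose_add, DirectSum.add_apply, DirectSum.add_apply,
      Submodule.coe_add, Submodule.coe_add, map_add, ha, hb]

theorem isHomogeneous_comap_mk {P : Ideal (A ⧸ I.toIdeal)}
    (hP : P.IsHomogeneous (quotientGrading 𝒜 I.toIdeal)) :
    (P.comap (Ideal.Quotient.mk I.toIdeal)).IsHomogeneous 𝒜 := by
  intro i a ha
  rw [Ideal.mem_comap, ← coe_decompose_mk]
  exact hP i ha

theorem isHomogeneous_map_mk {q : Ideal A} (hq : q.IsHomogeneous 𝒜) :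
    (q.map (Ideal.Quotient.mk I.toIdeal)).IsHomogeneous (quotientGrading 𝒜 I.toIdeal) := by
  intro i b hb
  obtain ⟨a, ha, rfl⟩ :=
    (Ideal.mem_map_iff_of_surjective _ Ideal.Quotient.mk_surjective).mp hb
  rw [coe_decompose_mk]
  exact Ideal.mem_map_of_mem _ (hq i ha)

end Quotient

section Height

variable {A : Type*} [CommRing A] {I : Ideal A}

theorem comap_map_mk_of_le {q : Ideal A} (h : I ≤ q) :
    (q.map (Ideal.Quotient.mk I)).comap (Ideal.Quotient.mk I) = q := by
  rw [Ideal.comap_map_of_surjective' _ Ideal.Quotient.mk_surjective, Ideal.mk_ker,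
    sup_eq_left.mpr h]

theorem isPrime_map_mk {q : Ideal A} [q.IsPrime] (h : I ≤ q) :
    (q.map (Ideal.Quotient.mk I)).IsPrime :=
  Ideal.map_isPrime_of_surjective Ideal.Quotient.mk_surjective (by rwa [Ideal.mk_ker])

theorem map_mk_lt_map_mk {p q : Ideal A} (hp : I ≤ p) (h : p < q) :
    p.map (Ideal.Quotient.mk I) < q.map (Ideal.Quotient.mk I) := by
  refine lt_of_le_of_ne (Ideal.map_mono h.le) fun heq => h.ne ?_
  rw [← comap_map_mk_of_le hp, heq, comap_map_mk_of_le (hp.trans h.le)]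

theorem eq_comap_of_height_eq_one [I.IsPrime] {P : Ideal (A ⧸ I)} [P.IsPrime] (hP : P.height = 1)
    {q : Ideal A} [q.IsPrime] (hq : I < q) (hle : q ≤ P.comap (Ideal.Quotient.mk I)) :
    q = P.comap (Ideal.Quotient.mk I) := by
  by_contra hne
  have h1 := map_mk_lt_map_mk le_rfl hq
  have h2 := map_mk_lt_map_mk hq.le (lt_of_le_of_ne hle hne)
  rw [Ideal.map_comap_of_surjective _ Ideal.Quotient.mk_surjective] at h2
  have := isPrime_map_mk hq.le
  have := isPrime_map_mk (le_refl I)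
  have h3 := Ideal.height_add_one_le_of_lt_of_isPrime h1
  have h4 := Ideal.height_add_one_le_of_lt_of_isPrime h2
  rw [hP] at h4
  have h5 := (add_le_add_left (le_add_self.trans h3) 1).trans h4
  norm_num at h5

end Height

section HeightOne

variable {k A : Type*} [CommRing k] [CommRing A] [Algebra k A] {𝒜 : ℕ → Submodule k A}
  [GradedAlgebra 𝒜]

theorem exists_homogeneous_mem_notMem {I q : Ideal A} (hq : q.IsHomogeneous 𝒜) (h : I < q) :
    ∃ d, ∃ f ∈ 𝒜 d, f ∈ q ∧ f ∉ I := by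
  classical
  obtain ⟨a, haq, haI⟩ := SetLike.exists_of_lt h
  by_contra! hcon
  apply haI
  rw [← DirectSum.sum_support_decompose 𝒜 a]
  exact sum_mem fun d _ => hcon d _ (DirectSum.decompose 𝒜 a d).2 (hq d haq)

/-- A homogeneous prime ideal has height one modulo `I` if no homogeneous prime ideal lies strictly
between. -/
theorem height_map_mk_eq_one [IsNoetherianRing A] (I : HomogeneousIdeal 𝒜) [I.toIdeal.IsPrime]
    {q : Ideal A} [q.IsPrime] (hq : q.IsHomogeneous 𝒜) (hlt : I.toIdeal < q)
    (h : ∀ p : Ideal A, p.IsPrime → p.IsHomogeneous 𝒜 → I.toIdeal < p → p ≤ q → p = q) :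
    (q.map (Ideal.Quotient.mk I.toIdeal)).height = 1 := by
  have hqp := isPrime_map_mk hlt.le
  refine le_antisymm ?_ ?_
  · obtain ⟨d, f, hf, hfq, hfI⟩ := exists_homogeneous_mem_notMem hq hlt
    refine Ideal.height_le_one_of_isPrincipal_of_mem_minimalPrimes
      (Ideal.span {Ideal.Quotient.mk I.toIdeal f}) _ ⟨⟨hqp, ?_⟩, ?_⟩
    · exact (Ideal.span_singleton_le_iff_mem _).mpr (Ideal.mem_map_of_mem _ hfq)
    -- By Krull's theorem it suffices that `q` is minimal over `f` modulo `I`. The homogeneous core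
    -- of a smaller prime still contains `f`, hence is strictly above `I` and equals `q`.
    · rintro Q ⟨hQ, hfQ⟩ hQq
      let p := Q.comap (Ideal.Quotient.mk I.toIdeal)
      have hp : p.IsPrime := Ideal.comap_isPrime _ _
      have hpc : (p.homogeneousCore 𝒜).toIdeal.IsPrime := hp.homogeneousCore
      have hle : (p.homogeneousCore 𝒜).toIdeal ≤ p := Ideal.toIdeal_homogeneousCore_le 𝒜 p
      have hIp : I.toIdeal ≤ p := fun a ha => by
        rw [Ideal.mem_comap, Ideal.Quotient.eq_zero_iff_mem.mpr ha]
        exact Q.zero_mem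
      have hIpc : I.toIdeal ≤ (p.homogeneousCore 𝒜).toIdeal := by
        rw [← I.toIdeal_homogeneousCore_eq_self]
        exact Ideal.homogeneousCore_mono 𝒜 hIp
      have hfp : f ∈ (p.homogeneousCore 𝒜).toIdeal :=
        Ideal.mem_homogeneousCore_of_homogeneous_of_mem ⟨d, hf⟩
          (hfQ (Ideal.mem_span_singleton_self _))
      have hpq : p ≤ q := (Ideal.comap_mono hQq).trans_eq (comap_map_mk_of_le hlt.le)
      have := h _ hpc (p.homogeneousCore 𝒜).isHomogeneous
        (lt_of_le_of_ne hIpc fun heq => hfI (heq ▸ hfp)) (hle.trans hpq)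
      rw [Ideal.map_le_iff_le_comap]
      exact this ▸ hle
  · have h1 := map_mk_lt_map_mk le_rfl hlt
    have := isPrime_map_mk (le_refl I.toIdeal)
    exact le_add_self.trans (Ideal.height_add_one_le_of_lt_of_isPrime h1)

end HeightOne

/-! ### The irrelevant ideal does not have height one -/

section Relevant

open MvPolynomial

variable {n : ℕ} {w : Fin (n + 1) → ℕ}

/-- If the quotient by `I` has dimension at most one, in the sense that chains of primes above `I`
have length at most one, then the height of `I` is at least the number of variables minus one. -/
theorem le_height_of_not_lt_and_lt {K : Type*} [Field K] {ι : Type*} [Finite ι]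
    (I : Ideal (MvPolynomial ι K)) [I.IsPrime]
    (h : ∀ q M : Ideal (MvPolynomial ι K), q.IsPrime → M.IsPrime → I < q → ¬ q < M) :
    (Nat.card ι : ℕ∞) ≤ I.height + 1 := by
  classical
  obtain ⟨s, hs, hcard⟩ := Ideal.exists_finset_card_eq_height_of_isNoetherianRing I
  have hfin := (Ideal.span (s : Set (MvPolynomial ι K))).finite_minimalPrimes_of_isNoetherianRing
  -- A maximal ideal `M` above `I` that avoids `g` contains no other minimal prime of (s); it exists
  -- by the Jacobson property.
  obtain ⟨g, hg, hgI⟩ : ∃ g ∈ (hfin.toFinset.erase I).inf id, g ∉ I := by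
    by_contra! hcon
    obtain ⟨q, hq, hqI⟩ := (Ideal.IsPrime.inf_le' ‹I.IsPrime›).mp hcon
    obtain ⟨hne, hq⟩ := Finset.mem_erase.mp hq
    have hq := hfin.mem_toFinset.mp hq
    exact hne (le_antisymm hqI (hs.2 hq.1 hqI))
  obtain ⟨M, hIM, hM, hgM⟩ : ∃ M, I ≤ M ∧ M.IsMaximal ∧ g ∉ M := by
    by_contra! hcon
    apply hgI
    rw [← IsJacobsonRing.out inferInstance (Ideal.IsPrime.isRadical ‹I.IsPrime›), Ideal.jacobson,
      Ideal.mem_sInf]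
    exact fun {M} hM => hcon M hM.1 hM.2
  rw [← height_eq_natCard_of_isMaximal M, ← hcard]
  by_cases hne : I = M
  · rw [← hne, hcard]
    exact le_self_add
  obtain ⟨b, hbM, hbI⟩ := SetLike.exists_of_lt (lt_of_le_of_ne hIM hne)
  -- A prime between (s, b) and `M` lies strictly above `I`, so it is `M`; hence ht M ≤ ht I + 1.
  refine (Ideal.height_le_card_of_mem_minimalPrimes_span_finset (s := insert b s) ?_).trans
    (by exact_mod_cast Finset.card_insert_le b s)
  rw [Finset.coe_insert]
  refine ⟨⟨hM.isPrime, Ideal.span_le.mpr (Set.insert_subset hbM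
    ((Ideal.span_le.mp hs.1.2).trans hIM))⟩, ?_⟩
  rintro q ⟨hq, hbsq⟩ hqM
  rw [Ideal.span_le, Set.insert_subset_iff] at hbsq
  obtain ⟨p, hp, hpq⟩ := Ideal.exists_minimalPrimes_le (Ideal.span_le.mpr hbsq.2)
  have hpI : p = I := by
    by_contra hpI
    exact hgM (hqM (hpq ((Finset.inf_le (f := id)
      (Finset.mem_erase.mpr ⟨hpI, hfin.mem_toFinset.mpr hp⟩)) hg)))
  rw [hpI] at hpq
  by_contra hMq
  exact h q M hq hM.isPrime (lt_of_le_of_ne hpq fun heq => hbI (heq ▸ hbsq.1))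
    (lt_of_le_not_ge hqM hMq)

theorem exists_X_notMem_of_height_lt {p : Ideal (MvPolynomial (Fin (n + 1)) ℂ)}
    [p.IsPrime] (hp : p.height < n) : ∃ i, X i ∉ p := by
  by_contra! h
  have : p.IsMaximal := by
    have hmk : Ideal.Quotient.mk p = (Ideal.Quotient.mk p).comp (C.comp constantCoeff) := by
      apply MvPolynomial.ringHom_ext
      · simp
      · intro i
        simpa using Ideal.Quotient.eq_zero_iff_mem.mpr (h i)
    have hker : RingHom.ker (constantCoeff (R := ℂ) (σ := Fin (n + 1))) ≤ p := by
      intro F hF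
      rw [← Ideal.Quotient.eq_zero_iff_mem, hmk, RingHom.comp_apply, RingHom.comp_apply,
        RingHom.mem_ker.mp hF, map_zero, map_zero]
    have hmax := RingHom.ker_isMaximal_of_surjective (constantCoeff (R := ℂ) (σ := Fin (n + 1)))
      fun c => ⟨C c, constantCoeff_C _ c⟩
    rwa [← hmax.eq_of_le Ideal.IsPrime.ne_top' hker]
  rw [height_eq_natCard_of_isMaximal, Nat.card_fin] at hp
  norm_cast at hp
  omega

/-- The irrelevant ideal does not have height one modulo a homogeneous prime of height less than
`n`. -/
theorem exists_X_notMem_comap_of_height_eq_one (hw_pos : ∀ i, 0 < w i)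
    (I : HomogeneousIdeal (grading w)) [I.toIdeal.IsPrime] (hI : I.toIdeal.height < n)
    {P : Ideal (MvPolynomial (Fin (n + 1)) ℂ ⧸ I.toIdeal)} [P.IsPrime]
    (hP : P.IsHomogeneous (quotientGrading (grading w) I.toIdeal)) (hP1 : P.height = 1) :
    ∃ i, X i ∉ P.comap (Ideal.Quotient.mk I.toIdeal) := by
  by_contra! hX
  set q := P.comap (Ideal.Quotient.mk I.toIdeal) with hq
  have hqp : q.IsPrime := Ideal.comap_isPrime _ _
  have hqh : q.IsHomogeneous (grading w) := isHomogeneous_comap_mk hP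
  have hIq : I.toIdeal ≤ q := by
    intro a ha
    rw [hq, Ideal.mem_comap, Ideal.Quotient.eq_zero_iff_mem.mpr ha]
    exact P.zero_mem
  have hlt : I.toIdeal < q := by
    refine lt_of_le_of_ne hIq fun heq => Ideal.ne_bot_of_height_eq_one hP1 ?_
    rw [← Ideal.map_comap_of_surjective _ Ideal.Quotient.mk_surjective P, ← hq, ← heq,
      Ideal.map_quotient_self]
  obtain ⟨d, f, hf, hfq, hfI⟩ := exists_homogeneous_mem_notMem hqh hlt
  have hd := ne_zero_of_mem_grading hw_pos hf (fun h => hfI (h ▸ I.toIdeal.zero_mem)) hqp.ne_top hfq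
  -- A prime containing `I` and `f` has its homogeneous core strictly above `I` and inside the
  -- irrelevant ideal `q`; height one forces the core to be `q`, so every variable is in the
  -- radical.
  have hint := isIntegral_aeval_of_X_mem_radical I.isHomogeneous hd hf fun i => by
    rw [Ideal.radical_eq_sInf, Ideal.mem_sInf]
    rintro Q ⟨hIfQ, hQ⟩
    obtain ⟨hIQ, hfQ⟩ := sup_le_iff.mp hIfQ
    have hcp : (Q.homogeneousCore (grading w)).toIdeal.IsPrime := hQ.homogeneousCore
    have hIc : I.toIdeal ≤ (Q.homogeneousCore (grading w)).toIdeal := by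
      rw [← I.toIdeal_homogeneousCore_eq_self]
      exact Ideal.homogeneousCore_mono _ hIQ
    have hfc : f ∈ (Q.homogeneousCore (grading w)).toIdeal :=
      Ideal.mem_homogeneousCore_of_homogeneous_of_mem ⟨d, hf⟩
        (hfQ (Ideal.mem_span_singleton_self _))
    have heq := eq_comap_of_height_eq_one hP1 (lt_of_le_of_ne hIc fun heq => hfI (heq ▸ hfc))
      (le_of_forall_X_mem hw_pos hX (Q.homogeneousCore (grading w)).isHomogeneous hcp.ne_top)
    refine Ideal.toIdeal_homogeneousCore_le (grading w) Q ?_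
    rw [heq]
    exact hX i
  have hle := le_height_of_not_lt_and_lt I.toIdeal fun q M hq hM hIq hqM => by
    have := isPrime_map_mk (le_refl I.toIdeal)
    have := isPrime_map_mk hIq.le
    have := isPrime_map_mk (hIq.trans hqM).le
    exact not_lt_and_lt_of_isIntegral _ hint (map_mk_lt_map_mk le_rfl hIq)
      (map_mk_lt_map_mk hIq.le hqM)
  rw [Nat.card_fin, Nat.cast_add, Nat.cast_one] at hle
  exact hI.not_ge (by simpa using hle)

end Relevant

end WeightedProj

/-! ### Singular locus and codimension in terms of homogeneous primes -/

namespace WeightedProj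

open MvPolynomial AlgebraicGeometry TopologicalSpace

theorem two_le_coheight_iff {α : Type*} [Preorder α] (a : α) :
    2 ≤ Order.coheight a ↔ ∃ b c, a < b ∧ b < c := by
  constructor
  · intro h
    obtain ⟨p, hp, hl⟩ := Order.exists_series_of_le_coheight a (n := 2) h
    refine ⟨p ⟨1, by omega⟩, p ⟨2, by omega⟩, ?_, ?_⟩
    · rw [← hp]
      exact p.strictMono (Fin.mk_lt_mk.mpr one_pos)
    · exact p.strictMono (Fin.mk_lt_mk.mpr one_lt_two)
  · rintro ⟨b, c, hab, hbc⟩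
    have h1 := Order.coheight_add_one_le hab
    have h2 := Order.coheight_add_one_le hbc
    calc (2 : ℕ∞) = 0 + 1 + 1 := by norm_num
      _ ≤ Order.coheight c + 1 + 1 := by gcongr; exact zero_le
      _ ≤ Order.coheight b + 1 := by gcongr
      _ ≤ _ := h1

variable {n : ℕ} {w : Fin (n + 1) → ℕ}

theorem exists_X_notMem_iff (hw_pos : ∀ i, 0 < w i) (p : HomogeneousIdeal (grading w)) :
    (∃ i, X i ∉ p.toIdeal) ↔ ¬ HomogeneousIdeal.irrelevant (grading w) ≤ p := by
  rw [← not_iff_not, not_not, not_exists_not]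
  constructor
  swap
  · intro h i
    refine h ((HomogeneousIdeal.mem_irrelevant_iff _ _).mpr ?_)
    exact DirectSum.decompose_of_mem_ne _ (X_mem_grading w i) (hw_pos i).ne'
  · intro h
    refine le_of_forall_X_mem (p := p.toIdeal) hw_pos h
      (HomogeneousIdeal.irrelevant (grading w)).isHomogeneous fun htop => ?_
    have h1 : (1 : MvPolynomial (Fin (n + 1)) ℂ) ∈ HomogeneousIdeal.irrelevant (grading w) :=
      (Ideal.eq_top_iff_one _).mp htop
    rw [HomogeneousIdeal.mem_irrelevant_iff, GradedRing.proj_apply] at h1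
    exact one_ne_zero ((DirectSum.decompose_of_mem_same _ SetLike.GradedOne.one_mem).symm.trans h1)

theorem mem_singularLocus_iff (hw_pos : ∀ i, 0 < w i) (hw : WellFormedTuple w)
    (x : ProjectiveSpectrum (grading w)) :
    (show weightedProj w from x) ∈ singularLocus (weightedProj w) ↔
      Nat.setGcd (degreesOutside (grading w) x.asHomogeneousIdeal.toIdeal) ≠ 1 := by
  have hx : x.asHomogeneousIdeal.toIdeal.IsPrime := x.isPrime
  let e : (weightedProj w).presheaf.stalk x ≃+*
      HomogeneousLocalization.AtPrime (grading w) x.asHomogeneousIdeal.toIdeal :=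
    Proj.stalkIso' (grading w) x
  have h1 : (show weightedProj w from x) ∈ singularLocus (weightedProj w) ↔
      ¬ IsRegularLocalRing
        (HomogeneousLocalization.AtPrime (grading w) x.asHomogeneousIdeal.toIdeal) :=
    not_congr ⟨fun _ => .of_ringEquiv e, fun _ => .of_ringEquiv e.symm⟩
  rw [h1]
  obtain ⟨i, hi⟩ := (exists_X_notMem_iff hw_pos x.asHomogeneousIdeal).mpr x.not_irrelevant_le
  refine ⟨fun h h1 => h (isRegularLocalRing_atPrime w _ x.asHomogeneousIdeal.isHomogeneous h1),
    fun h => not_isRegularLocalRing_atPrime hw (fun h0 => (hw_pos i).ne' ?_) h⟩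
  exact Nat.eq_zero_of_zero_dvd
    (h0 ▸ Nat.setGcd_dvd_of_mem ⟨X i, X_mem_grading w i, hi⟩)

section Codim

variable (I : HomogeneousIdeal (grading w))

/-- The homogeneous ideal of a point of `V₊(I)`. -/
def pointIdeal (x : vPlus w I) : HomogeneousIdeal (grading w) :=
  ProjectiveSpectrum.asHomogeneousIdeal (𝒜 := grading w) x.1

theorem mem_closure_singleton_iff (x y : vPlus w I) :
    y ∈ closure ({x} : Set (vPlus w I)) ↔ pointIdeal I x ≤ pointIdeal I y := by
  rw [← specializes_iff_mem_closure, subtype_specializes_iff, specializes_iff_mem_closure]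
  exact (ProjectiveSpectrum.le_iff_mem_closure (𝒜 := grading w) x.1 y.1).symm

theorem closure_singleton_lt_iff (x y : vPlus w I) :
    (⟨closure {x}, isIrreducible_singleton.closure, isClosed_closure⟩ :
        IrreducibleCloseds (vPlus w I)) <
      ⟨closure {y}, isIrreducible_singleton.closure, isClosed_closure⟩ ↔
      pointIdeal I y < pointIdeal I x := by
  have h (x y : vPlus w I) : (⟨closure {x}, isIrreducible_singleton.closure, isClosed_closure⟩ :
        IrreducibleCloseds (vPlus w I)) ≤
      ⟨closure {y}, isIrreducible_singleton.closure, isClosed_closure⟩ ↔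
      pointIdeal I y ≤ pointIdeal I x := by
    rw [← mem_closure_singleton_iff, ← Set.singleton_subset_iff,
      ← isClosed_closure.closure_subset_iff]
    rfl
  rw [lt_iff_le_not_ge, lt_iff_le_not_ge, h, h]

theorem exists_eq_closure_singleton (Y : IrreducibleCloseds (vPlus w I)) :
    ∃ x : vPlus w I, Y = ⟨closure {x}, isIrreducible_singleton.closure, isClosed_closure⟩ := by
  have hclosed : IsClosed (vPlus w I) := ProjectiveSpectrum.isClosed_zeroLocus (grading w) _
  have : QuasiSober (vPlus w I) := hclosed.isClosedEmbedding_subtypeVal.quasiSober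
  obtain ⟨x, hx⟩ := QuasiSober.sober Y.isIrreducible Y.isClosed
  exact ⟨x, IrreducibleCloseds.ext hx.def.symm⟩

/-- Irreducible closed subsets are closures of points, and the singular locus is stable under
specialization: a larger prime leaves fewer degrees outside, so its gcd is a multiple of the old
one. -/
theorem two_le_codim_iff (hw_pos : ∀ i, 0 < w i) (hw : WellFormedTuple w) :
    2 ≤ codim (vPlus w I) ((↑) ⁻¹' singularLocus (weightedProj w) : Set (vPlus w I)) ↔
      ∀ x : vPlus w I, Nat.setGcd (degreesOutside (grading w) (pointIdeal I x).toIdeal) ≠ 1 →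
        ∃ y z : vPlus w I, pointIdeal I y < pointIdeal I x ∧ pointIdeal I z < pointIdeal I y := by
  have hsing (x : vPlus w I) := mem_singularLocus_iff hw_pos hw x.1
  rw [codim, le_iInf₂_iff]
  constructor
  · intro h x hx
    have h1 := h ⟨closure {x}, isIrreducible_singleton.closure, isClosed_closure⟩ ?_
    · obtain ⟨Y, Y', hY, hY'⟩ := (two_le_coheight_iff _).mp h1
      obtain ⟨y, rfl⟩ := exists_eq_closure_singleton I Y
      obtain ⟨z, rfl⟩ := exists_eq_closure_singleton I Y'
      exact ⟨y, z, (closure_singleton_lt_iff I _ _).mp hY, (closure_singleton_lt_iff I _ _).mp hY'⟩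
    · intro y hy
      refine (hsing y).mpr fun h1 => hx (Nat.dvd_one.mp ((Nat.setGcd_mono ?_).trans h1.dvd))
      rintro d ⟨a, ha, hay⟩
      exact ⟨a, ha, fun hax => hay ((mem_closure_singleton_iff I x y).mp hy hax)⟩
  · intro h Y hY
    obtain ⟨x, rfl⟩ := exists_eq_closure_singleton I Y
    obtain ⟨y, z, hy, hz⟩ := h x ((hsing x).mp (hY (subset_closure rfl)))
    exact (two_le_coheight_iff _).mpr
      ⟨_, _, (closure_singleton_lt_iff I x y).mpr hy, (closure_singleton_lt_iff I y z).mpr hz⟩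

variable {I} in
theorem exists_pointIdeal_eq {p : HomogeneousIdeal (grading w)} (hp : p.toIdeal.IsPrime)
    (hirr : ¬ HomogeneousIdeal.irrelevant (grading w) ≤ p) (hI : I ≤ p) :
    ∃ x : vPlus w I, pointIdeal I x = p :=
  ⟨⟨(⟨p, hp, hirr⟩ : ProjectiveSpectrum (grading w)), hI⟩, rfl⟩

theorem le_pointIdeal (x : vPlus w I) : I ≤ pointIdeal I x := x.2

theorem isPrime_pointIdeal (x : vPlus w I) : (pointIdeal I x).toIdeal.IsPrime :=
  ProjectiveSpectrum.isPrime (𝒜 := grading w) x.1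

theorem not_irrelevant_le_pointIdeal (x : vPlus w I) :
    ¬ HomogeneousIdeal.irrelevant (grading w) ≤ pointIdeal I x :=
  ProjectiveSpectrum.not_irrelevant_le (𝒜 := grading w) x.1

end Codim

end WeightedProj

/-! ### The main equivalence -/

open WeightedProj in
theorem mainTheorem10 (n : ℕ) (hn : 2 ≤ n) (w : Fin (n + 1) → ℕ) (hw_pos : ∀ i, 0 < w i)
    (hw : WeightedProj.WellFormedTuple w)
    (I : HomogeneousIdeal (WeightedProj.grading w)) (hI_prime : I.toIdeal.IsPrime)
    (hI_height : I.toIdeal.height < n) :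
    WeightedProj.WellFormed w I ↔
      WeightedProj.saturationIndex
          (WeightedProj.quotientGrading (WeightedProj.grading w) I.toIdeal) = 1 ∧
        WeightedProj.SaturatedInCodimOne
          (WeightedProj.quotientGrading (WeightedProj.grading w) I.toIdeal) := by
  obtain ⟨x₀, hx₀⟩ := exists_pointIdeal_eq hI_prime
    ((exists_X_notMem_iff hw_pos I).mp (exists_X_notMem_of_height_lt hI_height)) le_rfl
  rw [WellFormed, and_iff_right hw, two_le_codim_iff I hw_pos hw, saturationIndex_quotientGrading]
  constructor
  · intro h
    have h1 : Nat.setGcd (degreesOutside (grading w) I.toIdeal) = 1 := by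
      by_contra hne
      -- `x₀` is the generic point of X, so no prime of a point of X lies strictly below its ideal.
      obtain ⟨y, -, hy, -⟩ := h x₀ (by rwa [hx₀])
      exact (hx₀ ▸ hy).not_ge (le_pointIdeal I y)
    refine ⟨h1, fun P hP hP1 => ?_⟩
    rw [saturationIndex_quotientGrading, saturationIndex_quotientGrading, h1,
      degreesOutside_quotientGrading]
    by_contra hne
    let q : HomogeneousIdeal (grading w) := ⟨_, isHomogeneous_comap_mk P.isHomogeneous⟩
    have hIq : I ≤ q := fun a ha => by
      change Ideal.Quotient.mk I.toIdeal a ∈ P.toIdeal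
      rw [Ideal.Quotient.eq_zero_iff_mem.mpr ha]
      exact P.toIdeal.zero_mem
    obtain ⟨x, hx⟩ := exists_pointIdeal_eq (p := q) (Ideal.comap_isPrime _ _)
      ((exists_X_notMem_iff hw_pos q).mp
        (exists_X_notMem_comap_of_height_eq_one hw_pos I hI_height P.isHomogeneous hP1)) hIq
    obtain ⟨y, z, hy, hz⟩ := h x (by rw [hx]; exact hne)
    have := isPrime_pointIdeal I y
    rw [hx] at hy
    exact hy.ne (HomogeneousIdeal.toIdeal_injective (eq_comap_of_height_eq_one hP1
      ((le_pointIdeal I z).trans_lt hz) hy.le))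
  · rintro ⟨h1, hsat⟩ x hx
    by_contra! hcon
    have hxp := isPrime_pointIdeal I x
    have hlt : I < pointIdeal I x :=
      lt_of_le_of_ne (le_pointIdeal I x) fun heq => hx (heq ▸ h1)
    have hheight := height_map_mk_eq_one I (pointIdeal I x).isHomogeneous hlt
      fun p hp hph hIp hpx => by
        by_contra hne
        let p' : HomogeneousIdeal (grading w) := ⟨p, hph⟩
        have hpx' : p' < pointIdeal I x :=
          lt_of_le_of_ne hpx fun heq => hne (congrArg HomogeneousIdeal.toIdeal heq)
        obtain ⟨y, hy⟩ := exists_pointIdeal_eq (p := p') hp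
          (fun hle => not_irrelevant_le_pointIdeal I x (hle.trans hpx)) hIp.le
        -- An intermediate homogeneous prime, relevant because it lies below that of `x`, would give
        -- the chain I < p < p_x excluded by `hcon`.
        refine hcon y x₀ (hy ▸ hpx') ?_
        rw [hx₀, hy]
        exact hIp
    have h2 := hsat ⟨_, isHomogeneous_map_mk (pointIdeal I x).isHomogeneous⟩
      (isPrime_map_mk hlt.le) hheight
    rw [saturationIndex_quotientGrading, saturationIndex_quotientGrading, h1,
      degreesOutside_quotientGrading] at h2
    refine hx (Eq.trans ?_ h2)
    congr 2
    exact (comap_map_mk_of_le hlt.le).symm
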